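/- \label{TeoremMarkovStructure} (Markov structure for zooming sets) Let $X$ be a compact, locally connected metric space (for instance a compact manifold; $X$ need not be connected), $f:X\to X$ a Borel measurable map and $\delta>0$. Let $\alpha=(\alpha_n)_{n\ge1}$ be a zooming contraction: nondecreasing functions $\alpha_n:[0,\infty)\to[0,\infty)$ with $\alpha_n(r)<r$ and $\alpha_n(\alpha_m(r))\le\alpha_{n+m}(r)$ for all $r>0$, $n,m\ge1$, and $\sup_{0\le r\le1}\sum_{n\ge1}\alpha_n(r)<\infty$. An integer $n\ge1$ is an $(\alpha,\delta)$-zooming time for $p\in X$ if there is an open neighbourhood $V$ of $p$ such that $f^n(V)=B_\delta(f^n(p))$, $f^n$ maps $\overline V$ homeomorphically onto $\overline{B_\delta(f^n(p))}$, and $d(f^j(x),f^j(y))\le\alpha_{n-j}(d(f^n(x),f^n(y)))$ for all $x,y\in V$ and $0\le j<n$. A set $\Lambda\subset X$ is an $(\alpha,\delta)$-zooming set if $f(\Lambda)\subset\Lambda$ and, for every $x\in\Lambda$, $$\limsup_{n\to\infty}\tfrac1n\#\{1\le j\le n : j\text{ is an }(\alpha,\delta)\text{-zooming time for }x\}>0.$$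 A Markov map $(F,\mathcal P)$ on a Borel set $U\subset X$ is a measurable map $F:U\to U$ with a countable collection $\mathcal P$ of Borel subsets of $U$ such that: (1) distinct elements of $\mathcal P$ have disjoint interiors; (2) for $P,Q\in\mathcal P$, if $F(P)\cap\operatorname{int}Q\neq\emptyset$ then $F(P)\supset\operatorname{int}Q$; (3) $\{F(P):P\in\mathcal P\}$ is finite; (4) each $F|_P$ is a homeomorphism onto $F(P)$ and extends to a homeomorphism of $\overline P$ onto $\overline{F(P)}$; (5) if $F^n(x)\in\bigcup_{P\in\mathcal P}P$ for all $n\ge0$, then $\operatorname{diam}\mathcal P_n(x)\to0$, where $\mathcal P_n(x)$ is the set of $y\in U$ such that, for each $0\le j\le n$, $F^j(x)$ and $F^j(y)$ lie in a common element of $\mathcal P$. It is full if $F(P)=U$ for all $P\in\mathcal P$. It is an induced Markov map for $f$ if there is an inducing time $R:U\to\{0,1,2,\dots\}$, constant on each $P\in\mathcal P$ (with value $R(P)$), with $\{R\ge1\}=\bigcup_{P\in\mathcal P}P$ and $F(x)=f^{R(x)}(x)$ for all $x\in U$. An ergodic $f$-invariant Borel probability $\mu$ is liftable to $F$ if there is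 an $F$-invariant finite measure $\nu\ll\mu$ on $U$ with $\mu=\sum_{P\in\mathcal P}\sum_{j=0}^{R(P)-1}f^j_*(\nu|_P)$. A Markov structure for $\Lambda$ is an at most countable collection of induced Markov maps for $f$ such that every ergodic $f$-invariant probability $\mu$ with $\mu(\Lambda)=1$ is liftable to at least one of them. A topological open ball of $X$ means here a nonempty connected open subset of $X$. Theorem. Every $(\alpha,\delta)$-zooming set $\Lambda$ admits a finite Markov structure $\mathfrak F=\{(F_1,\mathcal P_1),\dots,(F_s,\mathcal P_s)\}$ such that each $(F_i,\mathcal P_i)$ is a full induced Markov map defined on a topological open ball $U_i$ and all elements of $\mathcal P_i$ are topological open balls. Moreover every ergodic $f$-invariant probability $\mu$ with $\mu(\Lambda)>0$ is liftable to one of the $F_i$. (If $\Lambda$ is not measurable, $\mu(\Lambda)$ denotes the outer measure.) -/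

import Mathlib

open Set Filter Topology MeasureTheory
open scoped NNReal ENNReal

/-- A zooming contraction: a sequence `α 1, α 2, …` of nondecreasing functions `[0,∞) → [0,∞)`
(the value `α 0` is never used). The last field says `sup_{0 ≤ r ≤ 1} ∑_{n ≥ 1} α n r < ∞`. -/
structure IsZoomingContraction (α : ℕ → ℝ≥0 → ℝ≥0) : Prop where
  mono : ∀ n, 1 ≤ n → Monotone (α n)
  lt_self : ∀ n, 1 ≤ n → ∀ r, 0 < r → α n r < r
  comp_le : ∀ n m, 1 ≤ n → 1 ≤ m → ∀ r, 0 < r → α n (α m r) ≤ α (n + m) r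
  bounded_sum : ∃ C : ℝ≥0, ∀ r, r ≤ 1 → ∑' n : ℕ, (α (n + 1) r : ℝ≥0∞) ≤ C

/-- `g` sends `s` homeomorphically onto `t`. -/
def MapsHomeomorphically {X : Type*} [TopologicalSpace X] (g : X → X) (s t : Set X) : Prop :=
  ∃ e : s ≃ₜ t, ∀ x : s, (e x : X) = g x

/-- `V` is an `(α, δ)`-zooming pre-ball of order `n` of the point `p`. -/
structure IsZoomingPreball {X : Type*} [MetricSpace X] (α : ℕ → ℝ≥0 → ℝ≥0) (δ : ℝ) (f : X → X)
    (n : ℕ) (p : X) (V : Set X) : Prop where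
  isOpen : IsOpen V
  mem : p ∈ V
  image_eq : f^[n] '' V = Metric.ball (f^[n] p) δ
  homeo : MapsHomeomorphically f^[n] (closure V) (closure (Metric.ball (f^[n] p) δ))
  contract : ∀ x ∈ V, ∀ y ∈ V, ∀ j < n,
    nndist (f^[j] x) (f^[j] y) ≤ α (n - j) (nndist (f^[n] x) (f^[n] y))

/-- `n` is an `(α, δ)`-zooming time for `p`. -/
def IsZoomingTime {X : Type*} [MetricSpace X] (α : ℕ → ℝ≥0 → ℝ≥0) (δ : ℝ) (f : X → X)
    (n : ℕ) (p : X) : Prop :=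
  1 ≤ n ∧ ∃ V : Set X, IsZoomingPreball α δ f n p V

/-- `Λ` is an `(α, δ)`-zooming set: it is positively invariant and each of its points has
positive upper frequency of zooming times. -/
def IsZoomingSet {X : Type*} [MetricSpace X] (α : ℕ → ℝ≥0 → ℝ≥0) (δ : ℝ) (f : X → X)
    (Λ : Set X) : Prop :=
  (∀ x ∈ Λ, f x ∈ Λ) ∧
  ∀ x ∈ Λ, 0 < limsup
    (fun n : ℕ => (({j : ℕ | 1 ≤ j ∧ j ≤ n ∧ IsZoomingTime α δ f j x}.ncard : ℕ) : ℝ) / (n : ℝ))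
    atTop

/-- The set of points of `U` whose first `n` iterates under `F` lie in the same elements of
`P` as those of `x`. -/
def markovCylinder {X : Type*} (F : X → X) (U : Set X) (P : Set (Set X)) (n : ℕ) (x : X) :
    Set X :=
  {y ∈ U | ∀ j ≤ n, ∃ A ∈ P, F^[j] x ∈ A ∧ F^[j] y ∈ A}

/-- `(F, P)` is a Markov map defined on the Borel set `U`, that is, `F : U → U` is measurable and
`P` is a Markov partition of it. Only the values of `F` on `U` matter. -/
structure IsMarkovMap {X : Type*} [MetricSpace X] [MeasurableSpace X]
    (F : X → X) (U : Set X) (P : Set (Set X)) : Prop where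
  measurableSet_domain : MeasurableSet U
  mapsTo : MapsTo F U U
  measurable : Measurable (U.domRestrict F)
  countable : P.Countable
  measurableSet_part : ∀ A ∈ P, MeasurableSet A
  part_subset : ∀ A ∈ P, A ⊆ U
  disjoint_interior : ∀ A ∈ P, ∀ B ∈ P, A ≠ B → interior A ∩ interior B = ∅
  markov : ∀ A ∈ P, ∀ B ∈ P, (F '' A ∩ interior B).Nonempty → interior B ⊆ F '' A
  finite_images : {B : Set X | ∃ A ∈ P, B = F '' A}.Finite
  homeo : ∀ A ∈ P, MapsHomeomorphically F A (F '' A)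
  homeo_closure : ∀ A ∈ P, ∃ e : closure A ≃ₜ closure (F '' A),
    ∀ x : closure A, (x : X) ∈ A → (e x : X) = F x
  diam_tendsto : ∀ x ∈ U, (∀ n : ℕ, F^[n] x ∈ ⋃₀ P) →
    Tendsto (fun n : ℕ => Metric.diam (markovCylinder F U P n x)) atTop (𝓝 0)

/-- An induced Markov map for `f`: a Markov map `(map, parts)` on `domain` with
`map x = f^{time x} x` there. Only the values of `map` and `time` on `domain` matter. -/
structure InducedMarkovMap {X : Type*} [MetricSpace X] [MeasurableSpace X] (f : X → X) where
  domain : Set X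
  map : X → X
  parts : Set (Set X)
  time : X → ℕ
  isMarkovMap : IsMarkovMap map domain parts
  one_le_time : {x ∈ domain | 1 ≤ time x} = ⋃₀ parts
  time_const : ∀ A ∈ parts, ∀ x ∈ A, ∀ y ∈ A, time x = time y
  map_eq : ∀ x ∈ domain, map x = f^[time x] x

/-- The Markov map is full: every partition element is mapped onto the whole domain. -/
def InducedMarkovMap.IsFull {X : Type*} [MetricSpace X] [MeasurableSpace X] {f : X → X}
    (G : InducedMarkovMap f) : Prop :=
  ∀ A ∈ G.parts, G.map '' A = G.domain

/-- The common value `R(A)` of the inducing time on a partition element `A`. -/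
noncomputable def InducedMarkovMap.partTime {X : Type*} [MetricSpace X] [MeasurableSpace X]
    {f : X → X} (G : InducedMarkovMap f) (A : Set X) : ℕ :=
  sSup (G.time '' A)

/-- `μ` is liftable to `G`: there is a finite measure `ν ≪ μ` on `G.domain`, invariant under
`G.map : G.domain → G.domain`, with `μ = ∑_A ∑_{j < R(A)} f^j_* (ν|_A)`. -/
def InducedMarkovMap.IsLiftable {X : Type*} [MetricSpace X] [MeasurableSpace X] {f : X → X}
    (G : InducedMarkovMap f) (μ : Measure X) : Prop :=
  ∃ ν : Measure X, IsFiniteMeasure ν ∧ ν ≪ μ ∧ ν G.domainᶜ = 0 ∧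
    (∀ B : Set X, MeasurableSet B → ν (G.domain ∩ G.map ⁻¹' B) = ν B) ∧
    μ = Measure.sum (fun A : G.parts =>
      ∑ j ∈ Finset.range (G.partTime (A : Set X)), (ν.restrict (A : Set X)).map f^[j])

/-- A Markov structure for the set `Λ`: an at most countable collection of induced Markov maps
such that every ergodic `f`-invariant probability giving full measure to `Λ` lifts to one of
them. -/
def IsMarkovStructure {X : Type*} [MetricSpace X] [MeasurableSpace X] (f : X → X) (Λ : Set X)
    (𝔉 : Set (InducedMarkovMap f)) : Prop :=
  𝔉.Countable ∧ ∀ μ : Measure X, IsProbabilityMeasure μ → Ergodic f μ → μ Λ = 1 →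
    ∃ G ∈ 𝔉, G.IsLiftable μ

/-- Topological open balls of a general metric space, where there is no Euclidean model:
nonempty connected open sets. -/
def IsTopologicalOpenBall {X : Type*} [TopologicalSpace X] (U : Set X) : Prop :=
  IsOpen U ∧ IsConnected U

/-!
The proof separates a geometric construction from a measure-theoretic lifting principle.

*Lifting.* A schedule (`IsSchedule`) assigns to each point a set of times such that times
concatenate and, for two times `m < n` of `x`, the difference `n - m` is a time of `f^m x`. Since `f`
is only measurable, the image `f^m V` of a pre-ball need not be open, so `n - m` cannot be expected
to be a time of `f^m x` unless `m` itself is a time of `x`. Suppose that the times have positive upper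
frequency on a set of positive measure. Along such an orbit a definite proportion of the steps lands
in the set of points having many times in a window of fixed length (`IsSchedule.le_mul_visitCount`),
so the maximal inequality `measure_le_mul_of_frequent_visits` shows that the expected number of times
up to `W` grows linearly in `W` (`IsSchedule.mul_measure_le`). Hence the normalized measures
`B ↦ W⁻¹ ∑_{k < W} μ {x : k is a time of x, f^k x ∈ B}`, which are all dominated by `μ`, have a
nonzero limit `ν` along an ultrafilter. Each time has at most one predecessor, which makes `ν`
invariant under the jump to the first time and bounds its spread along the orbit pieces by `μ`. The
spread is `f`-invariant, so by ergodicity it is a multiple of `μ`, and `ν` only has to be rescaled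
(`IsSchedule.exists_lift`).

*Geometry.* Around each point a connected open core `U₀` is chosen inside a connected open base `B`,
together with an `ℓ` for which the sum of all contractions of order at least `ℓ` is much smaller than
the distance from `U₀` to the complement of `B`. Only inverse branches over `B` of order divisible by
`ℓ` are used. The core is enlarged by repeatedly adding the pullbacks of the present set which meet it
(`nestedHull`). Connectedness forces a branch that meets one of lower order at a point whose image is
near the core to be contained in it (`IsSeed.branch_subset_branch`), so the added pieces are reached from the core through branches of pairwise distinct
orders, and the enlarged set `U` stays inside `B` (`hullStage_structure`). It is a nested domain: a
pullback of `U` that meets `U` lies in `U` (`IsSeed.isNestedDomain_nestedHull`). Consequently the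
orders of the branches taking `x` into `U` form a schedule, and the jump to the first such order is a
full induced Markov map on `U` (`IsNestedDomain.inducedMarkovMap`).

By compactness finitely many cores cover the space. A point with positive upper frequency of zooming
times is taken with positive upper frequency into one of the cores, at times in one residue class
modulo the corresponding `ℓ`; after moving the origin to the first of these times they become return
times to the nested domain (`IsSeed.exists_frequently_returnTimes`), and the lifting principle
applies.
-/

/-! ### Counting and a maximal inequality -/

open Classical in
/-- The number of indices `k ∈ s` with `x ∈ T k`. -/
noncomputable def hitCount {X ι : Type*} (T : ι → Set X) (s : Finset ι) (x : X) : ℕ :=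
  (s.filter fun k => x ∈ T k).card

theorem hitCount_eq_sum {X ι : Type*} (T : ι → Set X) (s : Finset ι) (x : X) :
    (hitCount T s x : ℝ≥0∞) = ∑ k ∈ s, (T k).indicator 1 x := by
  classical
  rw [hitCount, Finset.card_filter]
  push_cast
  refine Finset.sum_congr rfl fun k _ => ?_
  by_cases h : x ∈ T k <;> simp [h]

theorem hitCount_le_card {X ι : Type*} (T : ι → Set X) (s : Finset ι) (x : X) :
    hitCount T s x ≤ s.card := by
  classical exact Finset.card_filter_le _ _

theorem hitCount_mono {X ι : Type*} (T : ι → Set X) {s t : Finset ι} (h : s ⊆ t) (x : X) :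
    hitCount T s x ≤ hitCount T t x := by
  classical exact Finset.card_le_card (Finset.filter_subset_filter _ h)

theorem measurable_hitCount {X ι : Type*} [MeasurableSpace X] {T : ι → Set X}
    (hT : ∀ k, MeasurableSet (T k)) (s : Finset ι) : Measurable (hitCount T s) := by
  classical
  have : hitCount T s = fun x => ∑ k ∈ s, (T k).indicator (fun _ => (1 : ℕ)) x := by
    funext x
    rw [hitCount, Finset.card_filter]
    refine Finset.sum_congr rfl fun k _ => ?_
    by_cases h : x ∈ T k <;> simp [h]
  rw [this]
  exact Finset.measurable_fun_sum _ fun k _ => measurable_const.indicator (hT k)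

theorem lintegral_hitCount {X ι : Type*} [MeasurableSpace X] (μ : Measure X) {T : ι → Set X}
    (hT : ∀ k, MeasurableSet (T k)) (s : Finset ι) :
    ∫⁻ x, (hitCount T s x : ℝ≥0∞) ∂μ = ∑ k ∈ s, μ (T k) := by
  simp_rw [hitCount_eq_sum]
  rw [lintegral_finsetSum _ fun k _ => measurable_one.indicator (hT k)]
  exact Finset.sum_congr rfl fun k _ => lintegral_indicator_one (hT k)

/-- If the sets `T i` covering a point can be injectively matched with sets `T' k ⊇ T i` covering
that point, then the measures compare. -/
theorem sum_measure_le_of_injOn {X ι κ : Type*} [MeasurableSpace X] (μ : Measure X)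
    {T : ι → Set X} {T' : κ → Set X} (hT : ∀ k, MeasurableSet (T k))
    (hT' : ∀ k, MeasurableSet (T' k)) (s : Finset ι) (t : Finset κ) (g : ι → κ)
    (hg : ∀ i ∈ s, g i ∈ t) (hsub : ∀ i ∈ s, T i ⊆ T' (g i))
    (hinj : ∀ i ∈ s, ∀ j ∈ s, g i = g j → (T i ∩ T j).Nonempty → i = j) :
    ∑ i ∈ s, μ (T i) ≤ ∑ k ∈ t, μ (T' k) := by
  classical
  rw [← lintegral_hitCount μ hT, ← lintegral_hitCount μ hT']
  refine lintegral_mono fun x => ?_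
  refine Nat.cast_le.2 ?_
  unfold hitCount
  refine Finset.card_le_card_of_injOn g (fun i hi => ?_) (fun i hi j hj hij => ?_)
  · simp only [Finset.coe_filter, mem_ofPred_eq] at hi ⊢
    exact ⟨hg i hi.1, hsub i hi.1 hi.2⟩
  · simp only [Finset.coe_filter, mem_ofPred_eq] at hi hj
    exact hinj i hi.1 j hj.1 hij ⟨x, hi.2, hj.2⟩

theorem ENNReal.le_of_forall_nat_mul_le {a b c : ℝ≥0∞} (ha : a ≠ ∞) (hc : c ≠ ∞)
    (h : ∀ n : ℕ, n * a ≤ n * b + c) : a ≤ b := by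
  by_contra! hlt
  have hb : b ≠ ∞ := hlt.ne_top
  lift a to ℝ≥0 using ha
  lift b to ℝ≥0 using hb
  lift c to ℝ≥0 using hc
  have hlt' : (b : ℝ) < a := by exact_mod_cast hlt
  obtain ⟨n, hn⟩ := exists_nat_gt ((c : ℝ) / (a - b))
  have h' : (n : ℝ) * a ≤ n * b + c := by exact_mod_cast h n
  rw [div_lt_iff₀ (by linarith)] at hn
  nlinarith

/-- The number of visits to `D` among the first `n` points of the orbit of `x`. -/
noncomputable def visitCount {X : Type*} (f : X → X) (D : Set X) (n : ℕ) (x : X) : ℕ :=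
  hitCount (fun i => f^[i] ⁻¹' D) (Finset.range n) x

theorem visitCount_add {X : Type*} (f : X → X) (D : Set X) (m n : ℕ) (x : X) :
    visitCount f D (m + n) x = visitCount f D m x + visitCount f D n (f^[m] x) := by
  classical
  simp only [visitCount, hitCount, Finset.card_filter, Finset.sum_range_add, mem_preimage]
  congr 1
  refine Finset.sum_congr rfl fun i _ => ?_
  rw [add_comm m i, Function.iterate_add_apply]

theorem visitCount_mono {X : Type*} (f : X → X) (D : Set X) {m n : ℕ} (h : m ≤ n) (x : X) :
    visitCount f D m x ≤ visitCount f D n x :=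
  hitCount_mono _ (Finset.range_subset_range.2 h) x

theorem visitCount_le {X : Type*} (f : X → X) (D : Set X) (n : ℕ) (x : X) :
    visitCount f D n x ≤ n := by
  simpa [visitCount] using hitCount_le_card (fun i => f^[i] ⁻¹' D) (Finset.range n) x

/-- Covering argument behind the maximal inequality: the stretches of orbit on which `D` is visited
with frequency at least `1 / K` are chosen greedily. -/
theorem visitCount_le_mul_visitCount {X : Type*} (f : X → X) (D A : Set X) (K M : ℕ)
    (hA : ∀ x ∈ A, ∃ n, 1 ≤ n ∧ n ≤ M ∧ n ≤ K * visitCount f D n x) (H : ℕ) :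
    ∀ x, visitCount f A H x ≤ K * visitCount f D (H + M) x := by
  classical
  induction H using Nat.strong_induction_on with
  | _ H ih =>
  intro x
  rcases Nat.eq_zero_or_pos H with rfl | hH
  · simp [visitCount, hitCount]
  by_cases hx : x ∈ A
  · obtain ⟨n, hn1, hnM, hn⟩ := hA x hx
    rcases le_or_gt H n with h | h
    · calc visitCount f A H x ≤ H := visitCount_le ..
        _ ≤ n := h
        _ ≤ K * visitCount f D n x := hn
        _ ≤ K * visitCount f D (H + M) x := by gcongr; exact visitCount_mono f D (by omega) x
    · have e1 : H = n + (H - n) := by omega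
      have e2 : H + M = n + (H - n + M) := by omega
      rw [e2, visitCount_add]
      conv_lhs => rw [e1]
      rw [visitCount_add, mul_add]
      exact add_le_add ((visitCount_le ..).trans hn) (ih _ (by omega) _)
  · have e1 : H = 1 + (H - 1) := by omega
    have e2 : H + M = 1 + (H - 1 + M) := by omega
    rw [e2, visitCount_add]
    conv_lhs => rw [e1]
    rw [visitCount_add, mul_add]
    refine add_le_add ?_ (ih _ (by omega) _)
    have : visitCount f A 1 x = 0 := by simp [visitCount, hitCount, hx]
    omega

/-- Maximal inequality for frequencies of visits. -/
theorem measure_le_mul_of_frequent_visits {X : Type*} [MeasurableSpace X] {μ : Measure X}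
    [IsProbabilityMeasure μ] {f : X → X} (hf : MeasurePreserving f μ μ) {D : Set X}
    (hD : MeasurableSet D) (K : ℕ) {A : Set X}
    (hA : ∀ x ∈ A, ∃ n, 1 ≤ n ∧ n ≤ K * visitCount f D n x) :
    μ A ≤ K * μ D := by
  have hpre : ∀ S : Set X, MeasurableSet S → ∀ i : ℕ, MeasurableSet (f^[i] ⁻¹' S) :=
    fun S hS i => (hf.measurable.iterate i) hS
  have hint : ∀ (S : Set X), MeasurableSet S → ∀ n : ℕ,
      ∫⁻ x, (visitCount f S n x : ℝ≥0∞) ∂μ = n * μ S := by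
    intro S hS n
    unfold visitCount
    rw [lintegral_hitCount μ (hpre S hS)]
    simp [(hf.iterate _).measure_preimage hS.nullMeasurableSet]
  let A' : ℕ → Set X := fun M => ⋃ n ∈ Finset.Icc 1 M, {x | n ≤ K * visitCount f D n x}
  have hA'm : ∀ M, MeasurableSet (A' M) := fun M =>
    Finset.measurableSet_biUnion _ fun n _ =>
      measurableSet_le measurable_const ((measurable_hitCount (hpre D hD) _).const_mul K)
  have hmono : Monotone A' := fun M N h =>
    biUnion_subset_biUnion_left (Finset.Icc_subset_Icc_right h)
  have hle : ∀ M, μ (A' M) ≤ K * μ D := by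
    intro M
    have hcov := visitCount_le_mul_visitCount f D (A' M) K M (by
      intro x hx
      simp only [A', mem_iUnion, Finset.mem_Icc, mem_ofPred_eq] at hx
      obtain ⟨n, hn, h⟩ := hx
      exact ⟨n, hn.1, hn.2, h⟩)
    refine ENNReal.le_of_forall_nat_mul_le (c := K * (M * μ D)) (measure_ne_top _ _)
      (by finiteness) fun H => ?_
    rw [← hint _ (hA'm M)]
    calc ∫⁻ x, (visitCount f (A' M) H x : ℝ≥0∞) ∂μ
        ≤ ∫⁻ x, (K * visitCount f D (H + M) x : ℝ≥0∞) ∂μ :=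
          lintegral_mono fun x => by
            rw [← Nat.cast_mul]; exact Nat.cast_le.2 (hcov H x)
      _ = K * ((H + M : ℕ) * μ D) := by
          rw [lintegral_const_mul' _ _ (by finiteness), hint D hD]
      _ = H * (K * μ D) + K * (M * μ D) := by push_cast; ring
  have hAsub : A ⊆ ⋃ M, A' M := by
    intro x hx
    obtain ⟨n, hn, h⟩ := hA x hx
    simp only [A', mem_iUnion, Finset.mem_Icc, mem_ofPred_eq]
    exact ⟨n, n, ⟨hn, le_rfl⟩, h⟩
  refine (measure_mono hAsub).trans ?_
  rw [hmono.measure_iUnion]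
  exact iSup_le hle

/-! ### Limits of dominated measures along an ultrafilter -/

/-- Measures dominated by a fixed finite measure have setwise limits along ultrafilters. -/
theorem exists_measure_tendsto_of_le {X : Type*} [MeasurableSpace X] {μ : Measure X}
    [IsFiniteMeasure μ] (m : ℕ → Measure X) (hm : ∀ n, m n ≤ μ) (l : Ultrafilter ℕ) :
    ∃ ν : Measure X, ν ≤ μ ∧
      ∀ B, MeasurableSet B → Tendsto (fun n => m n B) l (𝓝 (ν B)) := by
  let v : Set X → ℝ≥0∞ := fun B => (l.map fun n => m n B).lim
  have hv : ∀ B, Tendsto (fun n => m n B) l (𝓝 (v B)) := fun B =>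
    Ultrafilter.le_nhds_lim (l.map fun n => m n B)
  have hvle : ∀ B, v B ≤ μ B := fun B => le_of_tendsto' (hv B) fun n => hm n B
  have hmt : ∀ n B, m n B ≠ ∞ := fun n B => ((hm n B).trans_lt (measure_lt_top μ B)).ne
  have hvt : ∀ B, v B ≠ ∞ := fun B => ((hvle B).trans_lt (measure_lt_top μ B)).ne
  have hunion : ∀ s : ℕ → Set X, (∀ i, MeasurableSet (s i)) → Pairwise (Function.onFun Disjoint s) →
      v (⋃ i, s i) = ∑' i, v (s i) := by
    intro s hs hd
    have hsum : ∑' i, μ (s i) ≠ ∞ := by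
      rw [← measure_iUnion hd hs]; exact measure_ne_top _ _
    have hvsum : ∑' i, v (s i) ≠ ∞ :=
      ((ENNReal.tsum_le_tsum fun i => hvle (s i)).trans_lt hsum.lt_top).ne
    have key : Tendsto (fun n => ∑' i, (m n (s i)).toReal) l (𝓝 (∑' i, (v (s i)).toReal)) := by
      refine tendsto_tsum_of_dominated_convergence (bound := fun i => (μ (s i)).toReal)
        (ENNReal.summable_toReal hsum) (fun i => ?_) (Eventually.of_forall fun n i => ?_)
      · exact (ENNReal.tendsto_toReal (hvt _)).comp (hv _)
      · rw [Real.norm_of_nonneg ENNReal.toReal_nonneg]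
        exact ENNReal.toReal_mono (measure_ne_top _ _) (hm n _)
    refine tendsto_nhds_unique (hv _) ?_
    rw [← ENNReal.tendsto_toReal_iff (fun n => hmt n _) hvsum,
      ENNReal.tsum_toReal_eq fun i => hvt _]
    refine key.congr fun n => ?_
    rw [measure_iUnion hd hs, ENNReal.tsum_toReal_eq fun i => hmt _ _]
  have hv0 : v ∅ = 0 := by simpa using hvle ∅
  refine ⟨Measure.ofMeasurable (fun B _ => v B) hv0 fun s hs hd => hunion s hs hd, ?_, ?_⟩
  · refine Measure.le_iff.2 fun B hB => ?_
    rw [Measure.ofMeasurable_apply B hB]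
    exact hvle B
  · intro B hB
    rw [Measure.ofMeasurable_apply B hB]
    exact hv B

/-! ### Schedules of return times and lifting of ergodic measures -/

/-- A schedule of times for `f`: `x ∈ E n` says that `n` is a time of `x`. Times concatenate, and if
`m < n` are both times of `x` then `n - m` is a time of `f^m x`. It is not required that `n - m` be
a time of `f^m x` when `m` is not a time of `x`. -/
structure IsSchedule {X : Type*} (f : X → X) (E : ℕ → Set X) : Prop where
  zero : E 0 = ∅
  concat : ∀ n m x, x ∈ E n → f^[n] x ∈ E m → x ∈ E (n + m)
  sub : ∀ m n x, m < n → x ∈ E m → x ∈ E n → f^[m] x ∈ E (n - m)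

/-- The points whose first time is `m`. -/
def firstTimeAt {X : Type*} (E : ℕ → Set X) (m : ℕ) : Set X := {x | x ∈ E m ∧ ∀ i < m, x ∉ E i}

/-- The points without any time up to `j`. -/
def noTimeUpTo {X : Type*} (E : ℕ → Set X) (j : ℕ) : Set X := {x | ∀ i ≤ j, x ∉ E i}

theorem measurableSet_firstTimeAt {X : Type*} [MeasurableSpace X] {E : ℕ → Set X}
    (hE : ∀ n, MeasurableSet (E n)) (m : ℕ) : MeasurableSet (firstTimeAt E m) := by
  have : firstTimeAt E m = E m ∩ ⋂ i, ⋂ _ : i < m, (E i)ᶜ := by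
    ext x; simp [firstTimeAt]
  rw [this]
  exact (hE m).inter (MeasurableSet.iInter fun i => MeasurableSet.iInter fun _ => (hE i).compl)

theorem measurableSet_noTimeUpTo {X : Type*} [MeasurableSpace X] {E : ℕ → Set X}
    (hE : ∀ n, MeasurableSet (E n)) (j : ℕ) : MeasurableSet (noTimeUpTo E j) := by
  have : noTimeUpTo E j = ⋂ i, ⋂ _ : i ≤ j, (E i)ᶜ := by
    ext x; simp [noTimeUpTo]
  rw [this]
  exact MeasurableSet.iInter fun i => MeasurableSet.iInter fun _ => (hE i).compl

theorem measurableSet_frequently_mem {X : Type*} [MeasurableSpace X] {E : ℕ → Set X}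
    (hE : ∀ n, MeasurableSet (E n)) : MeasurableSet {x | ∃ᶠ n in atTop, x ∈ E n} := by
  have : {x | ∃ᶠ n in atTop, x ∈ E n} = ⋂ a, ⋃ b, ⋃ _ : a ≤ b, E b := by
    ext x; simp [frequently_atTop]
  rw [this]
  exact MeasurableSet.iInter fun a => MeasurableSet.iUnion fun b => MeasurableSet.iUnion fun _ => hE b

theorem iUnion_firstTimeAt {X : Type*} (E : ℕ → Set X) : ⋃ m, firstTimeAt E m = ⋃ n, E n := by
  classical
  ext x
  simp only [mem_iUnion]
  constructor
  · rintro ⟨m, hm⟩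
    exact ⟨m, hm.1⟩
  · intro h
    exact ⟨Nat.find h, Nat.find_spec h, fun i hi => Nat.find_min h hi⟩

theorem pairwise_disjoint_firstTimeAt {X : Type*} (E : ℕ → Set X) :
    Pairwise (Function.onFun Disjoint (firstTimeAt E)) := by
  intro m n hmn
  refine Set.disjoint_left.2 fun x hm hn => ?_
  rcases lt_or_gt_of_ne hmn with h | h
  · exact hn.2 m h hm.1
  · exact hm.2 n h hn.1

theorem noTimeUpTo_eq_union {X : Type*} (E : ℕ → Set X) (j : ℕ) :
    noTimeUpTo E j = noTimeUpTo E (j + 1) ∪ firstTimeAt E (j + 1) := by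
  ext x
  simp only [noTimeUpTo, firstTimeAt, mem_union, mem_ofPred_eq, Nat.lt_succ_iff]
  constructor
  · intro h
    by_cases hx : x ∈ E (j + 1)
    · exact Or.inr ⟨hx, h⟩
    · refine Or.inl fun i hi => ?_
      rcases Nat.lt_or_ge i (j + 1) with h' | h'
      · exact h i (by omega)
      · rwa [show i = j + 1 by omega]
  · rintro (h | h) i hi
    · exact h i (by omega)
    · exact h.2 i hi

theorem disjoint_noTimeUpTo_firstTimeAt {X : Type*} (E : ℕ → Set X) (j : ℕ) :
    Disjoint (noTimeUpTo E j) (firstTimeAt E j) :=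
  Set.disjoint_left.2 fun _ h h' => h j le_rfl h'.1

/-- If a point has at least `n / q` times up to `n`, then at a definite proportion of the steps up to
`n` its orbit visits the set of points having at least `L` times up to `2 * q * L`: in each stretch
of length `2 * q * L` at most `L` of the times fail to be followed by `L` further ones. -/
theorem IsSchedule.le_mul_visitCount {X : Type*} {f : X → X} {E : ℕ → Set X} (hE : IsSchedule f E)
    {q L n : ℕ} (hq : 1 ≤ q) (hL : 1 ≤ L) (hn : 4 * q * L < n) {x : X}
    (h : n ≤ q * hitCount E (Finset.Icc 1 n) x) :
    n + 1 ≤ 4 * q * visitCount f {y | L ≤ hitCount E (Finset.Icc 1 (2 * q * L)) y} (n + 1) x := by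
  classical
  set W := 2 * q * L with hW
  have hWpos : 0 < W := by positivity
  set D : Set X := {y | L ≤ hitCount E (Finset.Icc 1 W) y} with hD
  let S : Finset ℕ := (Finset.Icc 1 n).filter fun i => x ∈ E i
  let T : Finset ℕ := S.filter fun i => f^[i] x ∉ D
  have hS : S.card = hitCount E (Finset.Icc 1 n) x := by
    unfold hitCount; congr
  have hT : T.card ≤ L * (n / W + 1) := by
    have himg : (T.image fun i => i / W) ⊆ Finset.range (n / W + 1) := by
      intro b hb
      obtain ⟨i, hi, rfl⟩ := Finset.mem_image.1 hb
      have : i ≤ n := by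
        simp only [T, S, Finset.mem_filter, Finset.mem_Icc] at hi; omega
      exact Finset.mem_range.2 (Nat.lt_succ_of_le (Nat.div_le_div_right this))
    refine (Finset.card_le_mul_card_image T L fun b hb => ?_).trans
      (Nat.mul_le_mul le_rfl ((Finset.card_le_card himg).trans (by simp)))
    set R := T.filter fun i => i / W = b with hR
    rcases R.eq_empty_or_nonempty with h0 | hne
    · simp [h0]
    -- the first sparse time of the block sees all the others
    set i₀ := R.min' hne with hi₀
    have hi₀R : i₀ ∈ R := R.min'_mem hne
    have hmem : ∀ i ∈ R, x ∈ E i ∧ f^[i] x ∉ D ∧ i / W = b := by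
      intro i hi
      simp only [hR, T, S, Finset.mem_filter] at hi
      exact ⟨hi.1.1.2, hi.1.2, hi.2⟩
    have hcard : (R.erase i₀).card ≤ hitCount E (Finset.Icc 1 W) (f^[i₀] x) := by
      unfold hitCount
      refine Finset.card_le_card_of_injOn (fun i => i - i₀) (fun i hi => ?_) fun i hi j hj hij => ?_
      · obtain ⟨hne', hi⟩ := Finset.mem_erase.1 hi
        have hle : i₀ ≤ i := R.min'_le i hi
        have hlt : i₀ < i := lt_of_le_of_ne hle (Ne.symm hne')
        have h1 := Nat.div_add_mod i W
        have h2 := Nat.div_add_mod i₀ W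
        have h3 := Nat.mod_lt i hWpos
        rw [(hmem i hi).2.2] at h1
        rw [(hmem i₀ hi₀R).2.2] at h2
        simp only [Finset.coe_filter, Finset.mem_Icc, mem_ofPred_eq]
        exact ⟨by omega, hE.sub i₀ i x hlt (hmem i₀ hi₀R).1 (hmem i hi).1⟩
      · have hi' := R.min'_le i (Finset.mem_of_mem_erase hi)
        have hj' := R.min'_le j (Finset.mem_of_mem_erase hj)
        simp only at hij
        omega
    have hnot : hitCount E (Finset.Icc 1 W) (f^[i₀] x) < L := not_le.1 (hmem i₀ hi₀R).2.1
    rw [Finset.card_erase_of_mem hi₀R] at hcard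
    omega
  have hv : (S \ T).card ≤ visitCount f D (n + 1) x := by
    unfold visitCount hitCount
    refine Finset.card_le_card fun i hi => ?_
    simp only [T, S, Finset.mem_sdiff, Finset.mem_filter, Finset.mem_Icc, not_and, not_not] at hi
    simp only [Finset.mem_filter, Finset.mem_range, mem_preimage]
    exact ⟨by omega, hi.2 hi.1⟩
  have hsub : S.card ≤ visitCount f D (n + 1) x + L * (n / W + 1) := by
    have := Finset.le_card_sdiff T S
    omega
  have hdiv : q * (L * (n / W)) * 2 ≤ n := by
    calc q * (L * (n / W)) * 2 = W * (n / W) := by rw [hW]; ring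
      _ ≤ n := Nat.mul_div_le n W
  rw [hS] at hsub
  have := Nat.mul_le_mul_left q hsub
  nlinarith

/-- A positive upper frequency of times on a set of positive measure forces the mean number of times
to grow linearly. -/
theorem IsSchedule.mul_measure_le {X : Type*} [MeasurableSpace X] {μ : Measure X}
    [IsProbabilityMeasure μ] {f : X → X} (hf : MeasurePreserving f μ μ) {E : ℕ → Set X}
    (hE : IsSchedule f E) (hEm : ∀ n, MeasurableSet (E n)) {q L : ℕ} (hq : 1 ≤ q) (hL : 1 ≤ L) :
    L * μ {x | ∃ᶠ n in atTop, n ≤ q * hitCount E (Finset.Icc 1 n) x} ≤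
      4 * q * ∑ k ∈ Finset.range (2 * q * L + 1), μ (E k) := by
  set W := 2 * q * L
  set D : Set X := {y | L ≤ hitCount E (Finset.Icc 1 W) y} with hD
  have hDm : MeasurableSet D := measurableSet_le measurable_const (measurable_hitCount hEm _)
  have h1 : μ {x | ∃ᶠ n in atTop, n ≤ q * hitCount E (Finset.Icc 1 n) x} ≤
      (4 * q : ℕ) * μ D := by
    refine measure_le_mul_of_frequent_visits hf hDm (4 * q) fun x hx => ?_
    obtain ⟨n, hn, h⟩ := (frequently_atTop.1 hx) (4 * q * L + 1)
    exact ⟨n + 1, by omega, hE.le_mul_visitCount hq hL hn h⟩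
  have h2 : L * μ D ≤ ∑ k ∈ Finset.range (W + 1), μ (E k) := by
    calc L * μ D = L * μ {y | (L : ℝ≥0∞) ≤ (hitCount E (Finset.Icc 1 W) y : ℝ≥0∞)} := by
          simp [hD]
      _ ≤ ∫⁻ y, (hitCount E (Finset.Icc 1 W) y : ℝ≥0∞) ∂μ :=
          mul_meas_ge_le_lintegral ((measurable_from_top (f := fun n : ℕ => (n : ℝ≥0∞))).comp
            (measurable_hitCount hEm _)) _
      _ = ∑ k ∈ Finset.Icc 1 W, μ (E k) := lintegral_hitCount μ hEm _
      _ ≤ _ := Finset.sum_le_sum_of_subset fun k hk => by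
          simp only [Finset.mem_Icc, Finset.mem_range] at hk ⊢; omega
  calc L * μ _ ≤ L * ((4 * q : ℕ) * μ D) := by gcongr
    _ = 4 * q * (L * μ D) := by push_cast; ring
    _ ≤ _ := by gcongr

/-- The points with infinitely many times still form a schedule when each `E n` is cut down to
them. -/
theorem IsSchedule.inter_frequently {X : Type*} {f : X → X} {E : ℕ → Set X}
    (hE : IsSchedule f E) : IsSchedule f fun n => E n ∩ {x | ∃ᶠ k in atTop, x ∈ E k} where
  zero := by simp [hE.zero]
  concat n m x hn hm := ⟨hE.concat n m x hn.1 hm.1, hn.2⟩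
  sub m n x hmn hm hn := by
    refine ⟨hE.sub m n x hmn hm.1 hn.1, frequently_atTop.2 fun a => ?_⟩
    obtain ⟨b, hb, hxb⟩ := frequently_atTop.1 hm.2 (a + m + 1)
    exact ⟨b - m, by omega, hE.sub m b x (by omega) hm.1 hxb⟩

/-- The expected number, over the times `k < W`, of `k` with `f^k x ∈ S`. -/
noncomputable def timeMass {X : Type*} [MeasurableSpace X] (μ : Measure X) (f : X → X)
    (E : ℕ → Set X) (W : ℕ) (S : Set X) : ℝ≥0∞ :=
  ∑ k ∈ Finset.range W, μ (E k ∩ f^[k] ⁻¹' S)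

section timeMass

variable {X : Type*} [MeasurableSpace X] {μ : Measure X} [IsProbabilityMeasure μ] {f : X → X}
  {E : ℕ → Set X}

/-- Each time other than the first is reached from exactly one preceding time. -/
theorem sum_timeMass_firstTimeAt_le (hf : Measurable f) (hE : IsSchedule f E)
    (hEm : ∀ n, MeasurableSet (E n)) {B : Set X} (hB : MeasurableSet B) (M W : ℕ) :
    ∑ m ∈ Finset.range M, timeMass μ f E W (firstTimeAt E m ∩ f^[m] ⁻¹' B) ≤
      timeMass μ f E W B + M := by
  have hpre : ∀ (i : ℕ) {S : Set X}, MeasurableSet S → MeasurableSet (f^[i] ⁻¹' S) :=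
    fun i S hS => (hf.iterate i) hS
  unfold timeMass
  rw [← Finset.sum_product']
  have hstep := sum_measure_le_of_injOn μ
    (T := fun p : ℕ × ℕ => E p.2 ∩ f^[p.2] ⁻¹' (firstTimeAt E p.1 ∩ f^[p.1] ⁻¹' B))
    (T' := fun k => E k ∩ f^[k] ⁻¹' B)
    (fun p => (hEm _).inter (hpre _ ((measurableSet_firstTimeAt hEm _).inter (hpre _ hB))))
    (fun k => (hEm _).inter (hpre _ hB)) (Finset.range M ×ˢ Finset.range W)
    (Finset.range (W + M)) (fun p => p.2 + p.1)
    (by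
      intro p hp
      simp only [Finset.mem_product, Finset.mem_range] at hp ⊢
      omega)
    (by
      rintro ⟨m, k⟩ - x ⟨hk, hm, hB⟩
      refine ⟨hE.concat k m x hk hm.1, ?_⟩
      simpa only [mem_preimage, ← Function.iterate_add_apply, add_comm] using hB)
    (by
      rintro ⟨m, k⟩ - ⟨m', k'⟩ - hsum ⟨x, ⟨hk, hm, -⟩, ⟨hk', hm', -⟩⟩
      simp only at hsum hk hk' hm hm'
      rcases lt_trichotomy k k' with h | rfl | h
      · exact absurd (hE.sub k k' x h hk hk') (hm.2 _ (by
          have : m' ≠ 0 := by rintro rfl; simpa [hE.zero] using hm'.1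
          omega))
      · rw [show m = m' by omega]
      · exact absurd (hE.sub k' k x h hk' hk) (hm'.2 _ (by
          have : m ≠ 0 := by rintro rfl; simpa [hE.zero] using hm.1
          omega)))
  refine hstep.trans ?_
  rw [Finset.sum_range_add]
  gcongr
  calc _ ≤ ∑ _i ∈ Finset.range M, (1 : ℝ≥0∞) := Finset.sum_le_sum fun _ _ => prob_le_one
    _ = M := by simp

/-- Between two consecutive times the orbit passes through each step at most once. -/
theorem sum_timeMass_noTimeUpTo_le (hf : MeasurePreserving f μ μ) (hE : IsSchedule f E)
    (hEm : ∀ n, MeasurableSet (E n)) {B : Set X} (hB : MeasurableSet B) (J W : ℕ) :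
    ∑ j ∈ Finset.range J, timeMass μ f E W (noTimeUpTo E j ∩ f^[j] ⁻¹' B) ≤
      W * μ B + J := by
  have hpre : ∀ (i : ℕ) {S : Set X}, MeasurableSet S → MeasurableSet (f^[i] ⁻¹' S) :=
    fun i S hS => (hf.measurable.iterate i) hS
  unfold timeMass
  rw [← Finset.sum_product']
  have hstep := sum_measure_le_of_injOn μ
    (T := fun p : ℕ × ℕ => E p.2 ∩ f^[p.2] ⁻¹' (noTimeUpTo E p.1 ∩ f^[p.1] ⁻¹' B))
    (T' := fun k => f^[k] ⁻¹' B)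
    (fun p => (hEm _).inter (hpre _ ((measurableSet_noTimeUpTo hEm _).inter (hpre _ hB))))
    (fun k => hpre _ hB) (Finset.range J ×ˢ Finset.range W)
    (Finset.range (W + J)) (fun p => p.2 + p.1)
    (by
      intro p hp
      simp only [Finset.mem_product, Finset.mem_range] at hp ⊢
      omega)
    (by
      rintro ⟨m, k⟩ - x ⟨hk, hm, hB⟩
      simpa only [mem_preimage, ← Function.iterate_add_apply, add_comm] using hB)
    (by
      rintro ⟨m, k⟩ - ⟨m', k'⟩ - hsum ⟨x, ⟨hk, hm, -⟩, ⟨hk', hm', -⟩⟩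
      simp only at hsum hk hk' hm hm'
      rcases lt_trichotomy k k' with h | rfl | h
      · exact absurd (hE.sub k k' x h hk hk') (hm _ (by omega))
      · rw [show m = m' by omega]
      · exact absurd (hE.sub k' k x h hk' hk) (hm' _ (by omega)))
  refine hstep.trans ?_
  simp_rw [fun k => (hf.iterate k).measure_preimage hB.nullMeasurableSet]
  simp only [Finset.sum_const, Finset.card_range, nsmul_eq_mul, Nat.cast_add, add_mul]
  gcongr
  exact mul_le_of_le_one_right' prob_le_one

end timeMass

/-- A nonzero limit of the normalized `timeMass` measures. -/
theorem IsSchedule.exists_limit_timeMass {X : Type*} [MeasurableSpace X] {μ : Measure X}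
    [IsProbabilityMeasure μ] {f : X → X} (hf : MeasurePreserving f μ μ) {E : ℕ → Set X}
    (hE : IsSchedule f E) (hEm : ∀ n, MeasurableSet (E n)) {q : ℕ}
    (hpos : μ {x | ∃ᶠ n in atTop, n ≤ q * hitCount E (Finset.Icc 1 n) x} ≠ 0) :
    ∃ (ν : Measure X) (l : Ultrafilter ℕ) (w : ℕ → ℕ), ν ≤ μ ∧ ν univ ≠ 0 ∧
      Tendsto w l atTop ∧ ∀ S, MeasurableSet S →
        Tendsto (fun n => (w n : ℝ≥0∞)⁻¹ * timeMass μ f E (w n) S) l (𝓝 (ν S)) := by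
  have hq : 1 ≤ q := by
    by_contra! h0
    have hq0 : q = 0 := by omega
    subst hq0
    refine hpos (measure_mono_null (t := ∅) (fun x hx => ?_) measure_empty)
    obtain ⟨n, hn, h⟩ := frequently_atTop.1 hx 1
    simp at h; omega
  set A := {x | ∃ᶠ n in atTop, n ≤ q * hitCount E (Finset.Icc 1 n) x} with hA
  let w : ℕ → ℕ := fun n => 2 * q * (n + 1) + 1
  have hw0 : ∀ n, (w n : ℝ≥0∞) ≠ 0 := fun n => by simp [w]
  have hwt : ∀ n, (w n : ℝ≥0∞) ≠ ∞ := fun n => ENNReal.natCast_ne_top _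
  let m : ℕ → Measure X := fun n =>
    (w n : ℝ≥0∞)⁻¹ • ∑ k ∈ Finset.range (w n), (μ.restrict (E k)).map f^[k]
  have hm : ∀ n S, MeasurableSet S → m n S = (w n : ℝ≥0∞)⁻¹ * timeMass μ f E (w n) S := by
    intro n S hS
    simp only [m, timeMass, Measure.smul_apply, Measure.finsetSum_apply, smul_eq_mul]
    congr 1
    refine Finset.sum_congr rfl fun k _ => ?_
    rw [Measure.map_apply (hf.measurable.iterate k) hS,
      Measure.restrict_apply ((hf.measurable.iterate k) hS), inter_comm]
  have hmle : ∀ n, m n ≤ μ := by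
    refine fun n => Measure.le_iff.2 fun S hS => ?_
    rw [hm n S hS]
    calc (w n : ℝ≥0∞)⁻¹ * timeMass μ f E (w n) S
        ≤ (w n : ℝ≥0∞)⁻¹ * (w n * μ S) := by
          gcongr
          calc timeMass μ f E (w n) S ≤ ∑ _k ∈ Finset.range (w n), μ S :=
                Finset.sum_le_sum fun k _ => (measure_mono inter_subset_right).trans
                  ((hf.iterate k).measure_preimage hS.nullMeasurableSet).le
            _ = w n * μ S := by simp
      _ = μ S := by rw [← mul_assoc, ENNReal.inv_mul_cancel (hw0 n) (hwt n), one_mul]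
  let l : Ultrafilter ℕ := Filter.hyperfilter ℕ
  have hl : (l : Filter ℕ) ≤ atTop := Nat.hyperfilter_le_atTop
  obtain ⟨ν, hνμ, hν⟩ := exists_measure_tendsto_of_le m hmle l
  have hνt : ∀ S, MeasurableSet S →
      Tendsto (fun n => (w n : ℝ≥0∞)⁻¹ * timeMass μ f E (w n) S) l (𝓝 (ν S)) :=
    fun S hS => (hν S hS).congr fun n => hm n S hS
  refine ⟨ν, l, w, hνμ, ?_, ?_, hνt⟩
  · have hlow : μ A ≤ (4 * q * (4 * q) : ℕ) * ν univ := by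
      refine ge_of_tendsto' (ENNReal.Tendsto.const_mul (hνt univ MeasurableSet.univ)
        (Or.inr (ENNReal.natCast_ne_top _))) fun n => ?_
      have h1 := hE.mul_measure_le hf hEm hq (Nat.succ_le_succ (Nat.zero_le n))
      have h2 : timeMass μ f E (w n) univ = ∑ k ∈ Finset.range (w n), μ (E k) := by
        simp [timeMass]
      have h3 : w n ≤ 4 * q * (n + 1) := by simp only [w]; nlinarith
      rw [h2]
      calc μ A = (w n : ℝ≥0∞)⁻¹ * (w n * μ A) := by
            rw [← mul_assoc, ENNReal.inv_mul_cancel (hw0 n) (hwt n), one_mul]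
        _ ≤ (w n : ℝ≥0∞)⁻¹ * ((4 * q * (n + 1) : ℕ) * μ A) := by gcongr
        _ = (w n : ℝ≥0∞)⁻¹ * (4 * q * ((n + 1 : ℕ) * μ A)) := by push_cast; ring
        _ ≤ (w n : ℝ≥0∞)⁻¹ * (4 * q * (4 * q * ∑ k ∈ Finset.range (w n), μ (E k))) := by
            gcongr
        _ = _ := by push_cast; ring
    intro h0
    rw [h0, mul_zero] at hlow
    exact hpos (le_antisymm hlow bot_le)
  · refine (tendsto_atTop_mono (fun n => ?_) tendsto_id).mono_left hl
    simp only [w, id]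
    nlinarith

/-- The limit measure is invariant under the map that jumps to the first time, and spreading it along
the orbit pieces up to the first time gives a measure dominated by `μ`. -/
theorem IsSchedule.exists_jump_invariant {X : Type*} [MeasurableSpace X] {μ : Measure X}
    [IsProbabilityMeasure μ] {f : X → X} (hf : MeasurePreserving f μ μ) {E : ℕ → Set X}
    (hE : IsSchedule f E) (hEm : ∀ n, MeasurableSet (E n)) {q : ℕ}
    (hpos : μ {x | ∃ᶠ n in atTop, n ≤ q * hitCount E (Finset.Icc 1 n) x} ≠ 0)
    {U : Set X} (hU : MeasurableSet U) (hEU : ∀ n, ∀ x ∈ E n, f^[n] x ∈ U) :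
    ∃ ν : Measure X, ν ≤ μ ∧ ν univ ≠ 0 ∧ ν Uᶜ = 0 ∧ ν (⋃ n, E n)ᶜ = 0 ∧
      (∀ B, MeasurableSet B → ∑' m, ν (firstTimeAt E m ∩ f^[m] ⁻¹' B) = ν B) ∧
      ∀ B, MeasurableSet B → ∑' j, ν (noTimeUpTo E j ∩ f^[j] ⁻¹' B) ≤ μ B := by
  have hpre : ∀ (i : ℕ) {S : Set X}, MeasurableSet S → MeasurableSet (f^[i] ⁻¹' S) :=
    fun i S hS => (hf.measurable.iterate i) hS
  -- restricting to points with infinitely many times guarantees that every time has a successor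
  set Y : Set X := {x | ∃ᶠ k in atTop, x ∈ E k} with hY
  have hYm : MeasurableSet Y := measurableSet_frequently_mem hEm
  let E' : ℕ → Set X := fun n => E n ∩ Y
  have hE' : IsSchedule f E' := hE.inter_frequently
  have hE'm : ∀ n, MeasurableSet (E' n) := fun n => (hEm n).inter hYm
  have hpos' : μ {x | ∃ᶠ n in atTop, n ≤ q * hitCount E' (Finset.Icc 1 n) x} ≠ 0 := by
    refine fun h0 => hpos (measure_mono_null (fun x hx => ?_) h0)
    have hxY : x ∈ Y := by
      by_contra hxY
      obtain ⟨N, hN⟩ := eventually_atTop.1 (not_frequently.1 hxY)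
      obtain ⟨n, hn, h⟩ := frequently_atTop.1 hx (q * N + 1)
      have : hitCount E (Finset.Icc 1 n) x ≤ N := by
        classical
        unfold hitCount
        calc _ ≤ (Finset.range N).card := Finset.card_le_card fun k hk => by
              simp only [Finset.mem_filter] at hk
              by_contra hkN
              exact hN k (by simpa using hkN) hk.2
          _ = N := Finset.card_range N
      have := Nat.mul_le_mul_left q this
      omega
    have heq : ∀ s, hitCount E' s x = hitCount E s x := by
      intro s
      have : ∀ k, x ∈ E' k ↔ x ∈ E k := fun k => ⟨fun h => h.1, fun h => ⟨h, hxY⟩⟩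
      unfold hitCount
      congr 1
      ext k
      simp only [Finset.mem_filter, this]
    simpa only [mem_ofPred_eq, heq] using hx
  obtain ⟨ν, l, w, hνμ, hν0, hw, hlim⟩ := hE'.exists_limit_timeMass hf hE'm hpos'
  have : IsFiniteMeasure ν := isFiniteMeasure_of_le μ hνμ
  have hnull : ∀ S, MeasurableSet S → (∀ n, ∀ x ∈ E' n, f^[n] x ∉ S) → ν S = 0 := by
    intro S hS h
    refine tendsto_nhds_unique (hlim S hS) (tendsto_const_nhds.congr fun n => ?_)
    have : timeMass μ f E' (w n) S = 0 := by
      refine Finset.sum_eq_zero fun k _ => ?_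
      rw [show E' k ∩ f^[k] ⁻¹' S = ∅ from eq_empty_of_forall_notMem fun x hx => h k x hx.1 hx.2]
      exact measure_empty
    rw [this, mul_zero]
  have hYnull : ν Yᶜ = 0 := hnull _ hYm.compl fun n x hx h => h (by
    refine frequently_atTop.2 fun a => ?_
    obtain ⟨b, hb, hxb⟩ := frequently_atTop.1 hx.2 (a + n + 1)
    exact ⟨b - n, by omega, hE.sub n b x (by omega) hx.1 hxb⟩)
  have hUEm : MeasurableSet (⋃ n, E n) := MeasurableSet.iUnion hEm
  have hEnull : ν (⋃ n, E n)ᶜ = 0 := measure_mono_null (compl_subset_compl.2 fun x hx => by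
    obtain ⟨n, hn⟩ := hx.exists
    exact mem_iUnion.2 ⟨n, hn⟩) hYnull
  have hrest : ∀ S, MeasurableSet S → ν (S ∩ Y) = ν S := fun S hS =>
    measure_inter_conull hYnull
  have hfirst : ∀ m B, MeasurableSet B →
      ν (firstTimeAt E' m ∩ f^[m] ⁻¹' B) = ν (firstTimeAt E m ∩ f^[m] ⁻¹' B) := by
    intro m B hB
    rw [← hrest _ ((measurableSet_firstTimeAt hE'm m).inter (hpre m hB)),
      ← hrest _ ((measurableSet_firstTimeAt hEm m).inter (hpre m hB))]
    congr 1
    ext x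
    simp only [firstTimeAt, E', mem_inter_iff, mem_ofPred_eq]
    tauto
  have hno : ∀ j B, MeasurableSet B →
      ν (noTimeUpTo E' j ∩ f^[j] ⁻¹' B) = ν (noTimeUpTo E j ∩ f^[j] ⁻¹' B) := by
    intro m B hB
    rw [← hrest _ ((measurableSet_noTimeUpTo hE'm m).inter (hpre m hB)),
      ← hrest _ ((measurableSet_noTimeUpTo hEm m).inter (hpre m hB))]
    congr 1
    ext x
    simp only [noTimeUpTo, E', mem_inter_iff, mem_ofPred_eq]
    tauto
  have hwinf : Tendsto (fun n => (w n : ℝ≥0∞)⁻¹) l (𝓝 0) :=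
    ENNReal.tendsto_inv_nat_nhds_zero.comp hw
  have herr : ∀ M : ℕ, Tendsto (fun n => (w n : ℝ≥0∞)⁻¹ * M) l (𝓝 0) := fun M => by
    simpa using ENNReal.Tendsto.mul_const hwinf (Or.inr (ENNReal.natCast_ne_top M))
  have hle : ∀ B, MeasurableSet B → ∑' m, ν (firstTimeAt E m ∩ f^[m] ⁻¹' B) ≤ ν B := by
    intro B hB
    refine ENNReal.tsum_le_of_sum_range_le fun M => ?_
    simp_rw [← hfirst _ B hB]
    have h1 := tendsto_finsetSum (Finset.range M) fun m _ =>
      hlim _ ((measurableSet_firstTimeAt hE'm m).inter (hpre m hB))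
    have h2 := (hlim B hB).add (herr M)
    rw [add_zero] at h2
    refine le_of_tendsto_of_tendsto' h1 h2 fun n => ?_
    rw [← Finset.mul_sum, ← mul_add]
    gcongr
    exact sum_timeMass_firstTimeAt_le hf.measurable hE' hE'm hB M (w n)
  refine ⟨ν, hνμ, hν0, ?_, hEnull, fun B hB => ?_, fun B hB => ?_⟩
  · exact hnull _ hU.compl fun n x hx h => h (hEU n x hx.1)
  · -- the two inequalities for `B` and `Bᶜ` add up to an equality of total masses
    have htot : ∑' m, ν (firstTimeAt E m ∩ f^[m] ⁻¹' B) +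
        ∑' m, ν (firstTimeAt E m ∩ f^[m] ⁻¹' Bᶜ) = ν B + ν Bᶜ := by
      rw [← ENNReal.tsum_add, measure_add_measure_compl hB]
      calc ∑' m, (ν (firstTimeAt E m ∩ f^[m] ⁻¹' B) + ν (firstTimeAt E m ∩ f^[m] ⁻¹' Bᶜ))
          = ∑' m, ν (firstTimeAt E m) := by
            congr 1; funext m
            rw [preimage_compl, ← Set.sdiff_eq]
            exact measure_inter_add_sdiff _ (hpre m hB)
        _ = ν (⋃ n, E n) := by
            rw [← measure_iUnion (pairwise_disjoint_firstTimeAt E)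
              (measurableSet_firstTimeAt hEm), iUnion_firstTimeAt]
        _ = ν univ := by
            rw [← measure_add_measure_compl hUEm, hEnull, add_zero]
    refine le_antisymm (hle B hB) ?_
    by_contra! hlt
    have := ENNReal.add_lt_add_of_lt_of_le
      ((hle Bᶜ hB.compl).trans_lt (measure_lt_top ν _)).ne hlt (hle Bᶜ hB.compl)
    exact this.ne htot
  · refine ENNReal.tsum_le_of_sum_range_le fun J => ?_
    simp_rw [← hno _ B hB]
    have h1 := tendsto_finsetSum (Finset.range J) fun m _ =>
      hlim _ ((measurableSet_noTimeUpTo hE'm m).inter (hpre m hB))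
    have h2 := (tendsto_const_nhds (x := μ B)).add (herr J)
    rw [add_zero] at h2
    refine le_of_tendsto_of_tendsto h1 h2 ((hw.eventually_gt_atTop 0).mono fun n hn => ?_)
    have hn0 : (w n : ℝ≥0∞) ≠ 0 := by exact_mod_cast hn.ne'
    simp only
    rw [← Finset.mul_sum]
    calc _ ≤ (w n : ℝ≥0∞)⁻¹ * (w n * μ B + J) := by
          gcongr
          exact sum_timeMass_noTimeUpTo_le hf hE' hE'm hB J (w n)
      _ = μ B + (w n : ℝ≥0∞)⁻¹ * J := by
          rw [mul_add, ← mul_assoc, ENNReal.inv_mul_cancel hn0 (ENNReal.natCast_ne_top _), one_mul]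

/-- An ergodic measure for which the schedule has positive upper frequency of times is the spread of
a finite measure invariant under the map that jumps to the first time. -/
theorem IsSchedule.exists_lift {X : Type*} [MeasurableSpace X] {μ : Measure X}
    [IsProbabilityMeasure μ] {f : X → X} (hμ : Ergodic f μ) {E : ℕ → Set X}
    (hE : IsSchedule f E) (hEm : ∀ n, MeasurableSet (E n)) {q : ℕ}
    (hpos : μ {x | ∃ᶠ n in atTop, n ≤ q * hitCount E (Finset.Icc 1 n) x} ≠ 0)
    {U : Set X} (hU : MeasurableSet U) (hEU : ∀ n, ∀ x ∈ E n, f^[n] x ∈ U) :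
    ∃ ν : Measure X, IsFiniteMeasure ν ∧ ν ≪ μ ∧ ν Uᶜ = 0 ∧ ν (⋃ n, E n)ᶜ = 0 ∧
      (∀ B, MeasurableSet B → ∑' m, ν (firstTimeAt E m ∩ f^[m] ⁻¹' B) = ν B) ∧
      ∀ B, MeasurableSet B → μ B = ∑' j, ν (noTimeUpTo E j ∩ f^[j] ⁻¹' B) := by
  have hf : MeasurePreserving f μ μ := hμ.toMeasurePreserving
  have hpre : ∀ (i : ℕ) {S : Set X}, MeasurableSet S → MeasurableSet (f^[i] ⁻¹' S) :=
    fun i S hS => (hf.measurable.iterate i) hS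
  obtain ⟨ν, hνμ, hν0, hνU, hνE, hinv, hle⟩ := hE.exists_jump_invariant hf hEm hpos hU hEU
  have : IsFiniteMeasure ν := isFiniteMeasure_of_le μ hνμ
  let η : Measure X := Measure.sum fun j => (ν.restrict (noTimeUpTo E j)).map f^[j]
  have hη : ∀ B, MeasurableSet B → η B = ∑' j, ν (noTimeUpTo E j ∩ f^[j] ⁻¹' B) := by
    intro B hB
    rw [Measure.sum_apply _ hB]
    congr 1; funext j
    rw [Measure.map_apply (hf.measurable.iterate j) hB, Measure.restrict_apply (hpre j hB),
      inter_comm]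
  have hημ : η ≤ μ := Measure.le_iff.2 fun B hB => by rw [hη B hB]; exact hle B hB
  have : IsFiniteMeasure η := isFiniteMeasure_of_le μ hημ
  have hno0 : noTimeUpTo E 0 = univ := by
    ext x; simp [noTimeUpTo, hE.zero]
  have hfirst0 : firstTimeAt E 0 = ∅ := by
    ext x; simp [firstTimeAt, hE.zero]
  have hshift : ∀ B, MeasurableSet B →
      η B = ν B + ∑' j, ν (noTimeUpTo E (j + 1) ∩ f^[j + 1] ⁻¹' B) := by
    intro B hB
    rw [hη B hB, tsum_eq_zero_add' ENNReal.summable, hno0]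
    simp
  have hηf : MeasurePreserving f η η := by
    refine ⟨hf.measurable, Measure.ext fun B hB => ?_⟩
    rw [Measure.map_apply hf.measurable hB, hη _ (hf.measurable hB), hshift B hB]
    have hB' : ∑' j, ν (firstTimeAt E (j + 1) ∩ f^[j + 1] ⁻¹' B) = ν B := by
      rw [← hinv B hB, tsum_eq_zero_add' (f := fun m => ν (firstTimeAt E m ∩ f^[m] ⁻¹' B))
        ENNReal.summable, hfirst0]
      simp
    rw [← hB', ← ENNReal.tsum_add]
    congr 1; funext j
    have hpe : f^[j] ⁻¹' (f ⁻¹' B) = f^[j + 1] ⁻¹' B := by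
      ext x; simp only [mem_preimage, Function.iterate_succ_apply']
    rw [hpe, noTimeUpTo_eq_union, union_inter_distrib_right,
      add_comm (ν (firstTimeAt E (j + 1) ∩ f^[j + 1] ⁻¹' B))]
    exact measure_union ((disjoint_noTimeUpTo_firstTimeAt E (j + 1)).mono inter_subset_left
      inter_subset_left) ((measurableSet_firstTimeAt hEm _).inter (hpre (j + 1) hB))
  obtain ⟨c, hc⟩ := hμ.eq_smul_of_absolutelyContinuous hηf (Measure.absolutelyContinuous_of_le hημ)
  have hηc : ∀ B, η B = c * μ B := fun B => by rw [hc]; simp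
  have hc1 : c = η univ := by rw [hηc]; simp
  have hct : c ≠ ∞ := hc1 ▸ measure_ne_top η univ
  have hc0 : c ≠ 0 := by
    rw [hc1, hshift _ MeasurableSet.univ]
    exact fun h => hν0 (add_eq_zero.1 h).1
  have hci : c⁻¹ ≠ ∞ := ENNReal.inv_ne_top.2 hc0
  refine ⟨c⁻¹ • ν, Measure.smul_finite ν hci, ?_, ?_, ?_, fun B hB => ?_, fun B hB => ?_⟩
  · exact (Measure.absolutelyContinuous_of_le hνμ).smul_left _
  · rw [Measure.smul_apply, hνU, smul_zero]
  · rw [Measure.smul_apply, hνE, smul_zero]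
  · simp only [Measure.smul_apply, smul_eq_mul, ENNReal.tsum_mul_left, hinv B hB]
  · simp only [Measure.smul_apply, smul_eq_mul, ENNReal.tsum_mul_left]
    rw [← hη B hB, hηc, ← mul_assoc, ENNReal.inv_mul_cancel hc0 hct, one_mul]

/-! ### Injective continuous maps on compact sets -/

section Compact

variable {X : Type*} [TopologicalSpace X]

theorem MapsHomeomorphically.continuousOn {g : X → X} {s t : Set X}
    (h : MapsHomeomorphically g s t) : ContinuousOn g s := by
  obtain ⟨e, he⟩ := h
  rw [continuousOn_iff_continuous_domRestrict]
  refine (continuous_subtype_val.comp e.continuous).congr fun x => he x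

theorem MapsHomeomorphically.injOn {g : X → X} {s t : Set X}
    (h : MapsHomeomorphically g s t) : InjOn g s := by
  obtain ⟨e, he⟩ := h
  intro x hx y hy hxy
  have : e ⟨x, hx⟩ = e ⟨y, hy⟩ := Subtype.ext (by rw [he, he]; exact hxy)
  simpa using this

variable [T2Space X]

theorem isEmbedding_comp_val_of_isCompact {g : X → X} {K S : Set X} (hK : IsCompact K)
    (hc : ContinuousOn g K) (hi : InjOn g K) (hS : S ⊆ K) :
    IsEmbedding fun x : S => g x := by
  have : CompactSpace K := isCompact_iff_compactSpace.1 hK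
  have h : IsEmbedding fun x : K => g x :=
    (Continuous.isClosedEmbedding (continuousOn_iff_continuous_domRestrict.1 hc)
      (injOn_iff_injective.1 hi)).isEmbedding
  exact h.comp (IsEmbedding.inclusion hS)

theorem mapsHomeomorphically_of_isCompact {g : X → X} {K S : Set X} (hK : IsCompact K)
    (hc : ContinuousOn g K) (hi : InjOn g K) (hS : S ⊆ K) :
    MapsHomeomorphically g S (g '' S) := by
  have h := isEmbedding_comp_val_of_isCompact hK hc hi hS
  refine ⟨h.toHomeomorph.trans (Homeomorph.setCongr ?_), fun x => rfl⟩
  ext y; simp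

theorem isPreconnected_of_image_of_isCompact {g : X → X} {K S : Set X} (hK : IsCompact K)
    (hc : ContinuousOn g K) (hi : InjOn g K) (hS : S ⊆ K) (h : IsPreconnected (g '' S)) :
    IsPreconnected S := by
  have he := isEmbedding_comp_val_of_isCompact hK hc hi hS
  have himg : (fun x : S => g x) '' univ = g '' S := by
    rw [image_univ]; ext y; simp
  rw [← himg, he.isInducing.isPreconnected_image] at h
  simpa using h.image Subtype.val continuous_subtype_val.continuousOn

end Compact

/-! ### Zooming contractions -/

namespace IsZoomingContraction

variable {α : ℕ → ℝ≥0 → ℝ≥0}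

theorem map_zero (hα : IsZoomingContraction α) {n : ℕ} (hn : 1 ≤ n) : α n 0 = 0 := by
  by_contra h
  have hpos : 0 < α n 0 := pos_iff_ne_zero.2 h
  exact absurd (hα.lt_self n hn _ hpos) (not_lt.2 (hα.mono n hn bot_le))

theorem comp_le' (hα : IsZoomingContraction α) {n m : ℕ} (hn : 1 ≤ n) (hm : 1 ≤ m)
    (r : ℝ≥0) : α n (α m r) ≤ α (n + m) r := by
  rcases eq_or_ne r 0 with rfl | hr
  · rw [hα.map_zero hm, hα.map_zero hn]; exact bot_le
  · exact hα.comp_le n m hn hm r (pos_iff_ne_zero.2 hr)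

theorem summable_one (hα : IsZoomingContraction α) : Summable fun n => α (n + 1) 1 := by
  obtain ⟨C, hC⟩ := hα.bounded_sum
  exact ENNReal.tsum_coe_ne_top_iff_summable.1 (ne_top_of_le_ne_top ENNReal.coe_ne_top (hC 1 le_rfl))

end IsZoomingContraction

/-- The sum of the contractions of scale `1` of all orders at least `n`. -/
noncomputable def zoomTail (α : ℕ → ℝ≥0 → ℝ≥0) (n : ℕ) : ℝ≥0 := ∑' k, α (k + n) 1

theorem IsZoomingContraction.zoomTail_eq {α : ℕ → ℝ≥0 → ℝ≥0} (hα : IsZoomingContraction α) {n : ℕ}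
    (hn : 1 ≤ n) : zoomTail α n = α n 1 + zoomTail α (n + 1) := by
  have hs : Summable fun k => α (k + n) 1 := by
    have := (NNReal.summable_nat_add_iff (n - 1)).2 hα.summable_one
    refine this.congr fun k => ?_
    rw [show k + (n - 1) + 1 = k + n by omega]
  unfold zoomTail
  rw [tsum_eq_zero_add' ((NNReal.summable_nat_add_iff 1).2 hs)]
  simp only [zero_add]
  congr 2; funext k
  rw [show k + 1 + n = k + (n + 1) by ring]

theorem IsZoomingContraction.zoomTail_anti {α : ℕ → ℝ≥0 → ℝ≥0} (hα : IsZoomingContraction α)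
    {m n : ℕ} (hm : 1 ≤ m) (h : m ≤ n) : zoomTail α n ≤ zoomTail α m := by
  induction n, h using Nat.le_induction with
  | base => exact le_rfl
  | succ n hn ih =>
    refine le_trans ?_ ih
    rw [hα.zoomTail_eq (hm.trans hn)]
    exact le_add_self

theorem IsZoomingContraction.le_zoomTail {α : ℕ → ℝ≥0 → ℝ≥0} (hα : IsZoomingContraction α)
    {m n : ℕ} (hm : 1 ≤ m) (h : m ≤ n) : α n 1 ≤ zoomTail α m := by
  refine le_trans ?_ (hα.zoomTail_anti hm h)
  rw [hα.zoomTail_eq (hm.trans h)]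
  exact le_self_add

theorem tendsto_zoomTail (α : ℕ → ℝ≥0 → ℝ≥0) : Tendsto (zoomTail α) atTop (𝓝 0) :=
  NNReal.tendsto_sum_nat_add fun n => α n 1

/-! ### Branches -/

/-- `V` is an inverse branch of order `n` over the open set `B`: an open set that `f^n` maps
bijectively onto `B`, the map being continuous and injective up to the boundary of `V` and
contracting backwards at the zooming rates. -/
structure IsBranch {X : Type*} [MetricSpace X] (f : X → X) (α : ℕ → ℝ≥0 → ℝ≥0) (B : Set X)
    (n : ℕ) (V : Set X) : Prop where
  one_le : 1 ≤ n
  isOpen : IsOpen V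
  image_eq : f^[n] '' V = B
  continuousOn : ContinuousOn f^[n] (closure V)
  injOn : InjOn f^[n] (closure V)
  contract : ∀ x ∈ V, ∀ y ∈ V, ∀ j < n,
    nndist (f^[j] x) (f^[j] y) ≤ α (n - j) (nndist (f^[n] x) (f^[n] y))

namespace IsBranch

variable {X : Type*} [MetricSpace X] {f : X → X} {α : ℕ → ℝ≥0 → ℝ≥0} {B : Set X}
  {n m : ℕ} {V W : Set X}

theorem map_mem (hV : IsBranch f α B n V) {x : X} (hx : x ∈ V) : f^[n] x ∈ B :=
  hV.image_eq ▸ mem_image_of_mem _ hx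

theorem mem_of_mem_closure (hV : IsBranch f α B n V) {y : X} (hy : y ∈ closure V)
    (hyB : f^[n] y ∈ B) : y ∈ V := by
  obtain ⟨z, hz, hzy⟩ := hV.image_eq.symm ▸ hyB
  exact hV.injOn (subset_closure hz) hy hzy ▸ hz

/-- A connected set meeting a branch and mapped inside `B` cannot leave the branch. -/
theorem subset_of_isPreconnected (hV : IsBranch f α B n V) {C : Set X} (hC : IsPreconnected C)
    (hne : (C ∩ V).Nonempty) (hmaps : ∀ y ∈ C, f^[n] y ∈ B) : C ⊆ V :=
  hC.subset_of_closure_inter_subset hV.isOpen hne fun y hy =>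
    hV.mem_of_mem_closure hy.1 (hmaps y hy.2)

theorem image_inter_preimage (hV : IsBranch f α B n V) {A : Set X} (hA : A ⊆ B) :
    f^[n] '' (V ∩ f^[n] ⁻¹' A) = A := by
  rw [Set.image_inter_preimage, hV.image_eq, inter_eq_right.2 hA]

theorem isOpen_inter_preimage (hV : IsBranch f α B n V) {A : Set X} (hA : IsOpen A) :
    IsOpen (V ∩ f^[n] ⁻¹' A) :=
  (hV.continuousOn.mono subset_closure).isOpen_inter_preimage hV.isOpen hA

theorem comp (hα : IsZoomingContraction α) (hV : IsBranch f α B n V) (hW : IsBranch f α B m W)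
    (hWB : W ⊆ B) : IsBranch f α B (n + m) (V ∩ f^[n] ⁻¹' W) := by
  have hit : ∀ x, f^[n + m] x = f^[m] (f^[n] x) := fun x => by
    rw [add_comm, Function.iterate_add_apply]
  have hfun : f^[n + m] = f^[m] ∘ f^[n] := funext hit
  have hcl : closure (V ∩ f^[n] ⁻¹' W) ⊆ closure V := closure_mono inter_subset_left
  have hmaps : MapsTo f^[n] (closure (V ∩ f^[n] ⁻¹' W)) (closure W) := by
    have h : MapsTo f^[n] (V ∩ f^[n] ⁻¹' W) W := fun x hx => hx.2
    exact h.closure_of_continuousOn (hV.continuousOn.mono hcl)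
  refine ⟨hV.one_le.trans (Nat.le_add_right _ _), hV.isOpen_inter_preimage hW.isOpen, ?_, ?_, ?_, ?_⟩
  · rw [hfun, image_comp, hV.image_inter_preimage hWB, hW.image_eq]
  · rw [hfun]
    exact hW.continuousOn.comp (hV.continuousOn.mono hcl) hmaps
  · rw [hfun]
    exact hW.injOn.comp (hV.injOn.mono hcl) hmaps
  · rintro x ⟨hx, hxW⟩ y ⟨hy, hyW⟩ j hj
    rw [hit, hit]
    rcases lt_or_ge j n with h | h
    · calc nndist (f^[j] x) (f^[j] y) ≤ α (n - j) (nndist (f^[n] x) (f^[n] y)) :=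
            hV.contract x hx y hy j h
        _ ≤ α (n - j) (α m (nndist (f^[m] (f^[n] x)) (f^[m] (f^[n] y)))) :=
            hα.mono _ (by omega) (by simpa using hW.contract _ hxW _ hyW 0 (hW.one_le))
        _ ≤ α (n - j + m) (nndist (f^[m] (f^[n] x)) (f^[m] (f^[n] y))) :=
            hα.comp_le' (by omega) hW.one_le _
        _ = _ := by rw [show n - j + m = n + m - j by omega]
    · have := hW.contract _ hxW _ hyW (j - n) (by omega)
      rwa [← Function.iterate_add_apply, ← Function.iterate_add_apply, Nat.sub_add_cancel h,
        show m - (j - n) = n + m - j by omega] at this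

variable [CompactSpace X]

theorem isPreconnected_inter_preimage (hV : IsBranch f α B n V) {A : Set X} (hA : A ⊆ B)
    (hAc : IsPreconnected A) : IsPreconnected (V ∩ f^[n] ⁻¹' A) :=
  isPreconnected_of_image_of_isCompact isClosed_closure.isCompact hV.continuousOn hV.injOn
    (inter_subset_left.trans subset_closure) (by rwa [hV.image_inter_preimage hA])

theorem isPreconnected (hV : IsBranch f α B n V) (hB : IsPreconnected B) : IsPreconnected V := by
  have h := hV.isPreconnected_inter_preimage Subset.rfl hB
  have hVB : V ⊆ f^[n] ⁻¹' B := fun x hx => hV.map_mem hx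
  rwa [inter_eq_left.2 hVB] at h

/-- Although iterates of `f` need not be open maps, `f^n` is open on a branch of order `n` over an
open set. -/
theorem isOpen_image (hW : IsBranch f α B n W) (hB : IsOpen B) {S : Set X} (hS : IsOpen S)
    (hSW : S ⊆ W) : IsOpen (f^[n] '' S) := by
  have hK : IsCompact (closure W \ S) := isClosed_closure.isCompact.diff hS
  have hcl : IsClosed (f^[n] '' (closure W \ S)) :=
    (hK.image_of_continuousOn (hW.continuousOn.mono sdiff_subset)).isClosed
  have heq : f^[n] '' S = B \ f^[n] '' (closure W \ S) := by
    ext y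
    constructor
    · rintro ⟨x, hx, rfl⟩
      refine ⟨hW.map_mem (hSW hx), ?_⟩
      rintro ⟨z, ⟨hz, hzS⟩, hzx⟩
      exact hzS (hW.injOn hz (subset_closure (hSW hx)) hzx ▸ hx)
    · rintro ⟨hy, hyn⟩
      obtain ⟨x, hx, rfl⟩ := hW.image_eq.symm ▸ hy
      by_contra hxS
      exact hyn ⟨x, ⟨subset_closure hx, fun h => hxS ⟨x, h, rfl⟩⟩, rfl⟩
  rw [heq]
  exact hB.sdiff hcl

/-- The image under `f^m` of a branch contained in a branch of order `m` is again a branch. -/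
theorem image (hW : IsBranch f α B m W) (hV : IsBranch f α B n V) (hB : IsOpen B) (hmn : m < n)
    (hVW : V ⊆ W) : IsBranch f α B (n - m) (f^[m] '' V) := by
  have hit : ∀ x, f^[n - m] (f^[m] x) = f^[n] x := fun x => by
    rw [← Function.iterate_add_apply, Nat.sub_add_cancel hmn.le]
  have hclW : closure V ⊆ closure W := closure_mono hVW
  have hcl : closure (f^[m] '' V) = f^[m] '' closure V :=
    (image_closure_of_isCompact isClosed_closure.isCompact (hW.continuousOn.mono hclW)).symm
  refine ⟨by omega, hW.isOpen_image hB hV.isOpen hVW, ?_, ?_, ?_, ?_⟩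
  · rw [image_image]
    simp only [hit, hV.image_eq]
  · rw [hcl, continuousOn_iff_isClosed]
    intro t ht
    refine ⟨f^[m] '' (closure V ∩ f^[n] ⁻¹' t), ?_, ?_⟩
    · have h1 : IsClosed (closure V ∩ f^[n] ⁻¹' t) :=
        hV.continuousOn.preimage_isClosed_of_isClosed isClosed_closure ht
      exact (h1.isCompact.image_of_continuousOn
        (hW.continuousOn.mono (inter_subset_left.trans hclW))).isClosed
    · ext y
      constructor
      · rintro ⟨hy, x, hx, rfl⟩
        exact ⟨⟨x, ⟨hx, by simpa only [mem_preimage, hit] using hy⟩, rfl⟩, x, hx, rfl⟩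
      · rintro ⟨⟨x, ⟨hx, hxt⟩, rfl⟩, h⟩
        exact ⟨by simpa only [mem_preimage, hit] using hxt, h⟩
  · rw [hcl]
    rintro _ ⟨x, hx, rfl⟩ _ ⟨y, hy, rfl⟩ h
    rw [hit, hit] at h
    rw [hV.injOn hx hy h]
  · rintro _ ⟨x, hx, rfl⟩ _ ⟨y, hy, rfl⟩ j hj
    have := hV.contract x hx y hy (j + m) (by omega)
    rw [hit, hit]
    rwa [Function.iterate_add_apply, Function.iterate_add_apply,
      show n - (j + m) = n - m - j by omega] at this

end IsBranch

/-! ### Nested domains -/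

/-- A core `U₀` deep inside a connected open base `B` of diameter at most `1`: the contractions of
order at least `ℓ` are so small that points within reach of `U₀` in two steps stay in `B`. -/
structure IsSeed {X : Type*} [MetricSpace X] (α : ℕ → ℝ≥0 → ℝ≥0) (B U₀ : Set X) (ℓ : ℕ) :
    Prop where
  isOpen_base : IsOpen B
  isPreconnected_base : IsPreconnected B
  nndist_le_one : ∀ x ∈ B, ∀ y ∈ B, nndist x y ≤ 1
  isOpen_core : IsOpen U₀
  isConnected_core : IsConnected U₀
  one_le : 1 ≤ ℓ
  collar : ∀ u ∈ U₀, ∀ y z, nndist y u ≤ zoomTail α ℓ → nndist z y ≤ zoomTail α ℓ → z ∈ B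

/-- The stages of the growth of `U₀`: at each step, all pullbacks of the present set along branches
of order divisible by `ℓ` that meet it are added. -/
def hullStage {X : Type*} [MetricSpace X] (f : X → X) (α : ℕ → ℝ≥0 → ℝ≥0) (B U₀ : Set X) (ℓ : ℕ) :
    ℕ → Set X
  | 0 => U₀
  | k + 1 => hullStage f α B U₀ ℓ k ∪
      {y | ∃ n V, ℓ ∣ n ∧ IsBranch f α B n V ∧
        (∃ z ∈ V, f^[n] z ∈ hullStage f α B U₀ ℓ k ∧ z ∈ hullStage f α B U₀ ℓ k) ∧
        y ∈ V ∧ f^[n] y ∈ hullStage f α B U₀ ℓ k}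

/-- The smallest set containing `U₀` that contains each of its pullbacks which it meets. -/
def nestedHull {X : Type*} [MetricSpace X] (f : X → X) (α : ℕ → ℝ≥0 → ℝ≥0) (B U₀ : Set X) (ℓ : ℕ) :
    Set X :=
  ⋃ k, hullStage f α B U₀ ℓ k

section Hull

variable {X : Type*} [MetricSpace X] {f : X → X} {α : ℕ → ℝ≥0 → ℝ≥0} {B U₀ : Set X} {ℓ : ℕ}

theorem hullStage_mono : Monotone (hullStage f α B U₀ ℓ) :=
  monotone_nat_of_le_succ fun _ => subset_union_left

theorem IsBranch.nndist_le {n : ℕ} {V : Set X} (hα : IsZoomingContraction α)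
    (hS : IsSeed α B U₀ ℓ) (hV : IsBranch f α B n V) {x y : X} (hx : x ∈ V) (hy : y ∈ V) {j : ℕ}
    (hj : j < n) : nndist (f^[j] x) (f^[j] y) ≤ α (n - j) 1 :=
  (hV.contract x hx y hy j hj).trans
    (hα.mono _ (by omega) (hS.nndist_le_one _ (hV.map_mem hx) _ (hV.map_mem hy)))

/-- A branch that meets a branch of lower order at a point whose image is close to the core is
contained in it. -/
theorem IsSeed.branch_subset_branch [CompactSpace X] (hα : IsZoomingContraction α)
    (hS : IsSeed α B U₀ ℓ) {m n : ℕ} {V W : Set X} (hV : IsBranch f α B n V)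
    (hW : IsBranch f α B m W) (hmn : m ≤ n) (hℓ : ℓ ∣ n - m) {y u : X} (hyV : y ∈ V) (hyW : y ∈ W)
    (hu : u ∈ U₀) (hyu : nndist (f^[m] y) u ≤ zoomTail α ℓ) : V ⊆ W := by
  refine hW.subset_of_isPreconnected (hV.isPreconnected hS.isPreconnected_base) ⟨y, hyV, hyW⟩
    fun z hz => ?_
  rcases hmn.eq_or_lt with rfl | h
  · exact hV.map_mem hz
  · exact hS.collar u hu _ _ hyu ((hV.nndist_le hα hS hz hyV h).trans
      (hα.le_zoomTail hS.one_le (Nat.le_of_dvd (by omega) hℓ)))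

/-- Every point grown from the core lies in a branch which is close to the core. The chain of
branches leading from the core to the point can be taken with decreasing orders, because a branch
meeting one of lower order is contained in it; hence the distance is bounded by a tail of the
series of the contractions. -/
theorem hullStage_structure [CompactSpace X] (hα : IsZoomingContraction α) (hS : IsSeed α B U₀ ℓ)
    (k : ℕ) : ∀ y ∈ hullStage f α B U₀ ℓ k, y ∈ U₀ ∨ ∃ m W, ℓ ∣ m ∧ IsBranch f α B m W ∧
      (∀ z ∈ W, ∃ u ∈ U₀, nndist z u ≤ zoomTail α m) ∧ y ∈ W ∧
      f^[m] y ∈ hullStage f α B U₀ ℓ k := by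
  induction k with
  | zero => exact fun y hy => Or.inl hy
  | succ k ih =>
    have hnear : ∀ y ∈ hullStage f α B U₀ ℓ k, ∃ u ∈ U₀, nndist y u ≤ zoomTail α ℓ := by
      intro y hy
      rcases ih y hy with h | ⟨m, W, hm, hW, hgood, hyW, -⟩
      · exact ⟨y, h, by simp⟩
      · obtain ⟨u, hu, hyu⟩ := hgood y hyW
        exact ⟨u, hu, hyu.trans (hα.zoomTail_anti hS.one_le (Nat.le_of_dvd hW.one_le hm))⟩
    rintro y (hy | ⟨n, V, hn, hV, ⟨z, hzV, hfz, hz⟩, hyV, hfy⟩)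
    · rcases ih y hy with h | ⟨m, W, hm, hW, hgood, hyW, hfy⟩
      · exact Or.inl h
      · exact Or.inr ⟨m, W, hm, hW, hgood, hyW, subset_union_left hfy⟩
    right
    have hVdiam : ∀ x ∈ V, nndist x z ≤ α n 1 := fun x hx => by
      simpa using hV.nndist_le hα hS hx hzV (j := 0) hV.one_le
    rcases ih z hz with h0 | ⟨m, W, hm, hW, hgood, hzW, hfz'⟩
    · exact ⟨n, V, hn, hV, fun x hx => ⟨z, h0, (hVdiam x hx).trans
        (hα.le_zoomTail hV.one_le le_rfl)⟩, hyV, subset_union_left hfy⟩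
    rcases lt_or_ge n m with hnm | hmn
    · refine ⟨n, V, hn, hV, fun x hx => ?_, hyV, subset_union_left hfy⟩
      obtain ⟨u, hu, hzu⟩ := hgood z hzW
      refine ⟨u, hu, (nndist_triangle x z u).trans ?_⟩
      rw [hα.zoomTail_eq hV.one_le]
      exact add_le_add (hVdiam x hx) (hzu.trans (hα.zoomTail_anti (by omega) hnm))
    · obtain ⟨u, hu, hzu⟩ := hnear _ hfz'
      have hVW := hS.branch_subset_branch hα hV hW hmn (Nat.dvd_sub hn hm) hzV hzW hu hzu
      refine ⟨m, W, hm, hW, hgood, hVW hyV, ?_⟩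
      rcases hmn.eq_or_lt with rfl | hlt
      · exact subset_union_left hfy
      · have hit : ∀ x, f^[n - m] (f^[m] x) = f^[n] x := fun x => by
          rw [← Function.iterate_add_apply, Nat.sub_add_cancel hlt.le]
        exact Or.inr ⟨n - m, f^[m] '' V, Nat.dvd_sub hn hm,
          hW.image hV hS.isOpen_base hlt hVW,
          ⟨f^[m] z, mem_image_of_mem _ hzV, by rwa [hit], hfz'⟩,
          mem_image_of_mem _ hyV, by rwa [hit]⟩

theorem exists_core_near_of_mem_nestedHull [CompactSpace X] (hα : IsZoomingContraction α)
    (hS : IsSeed α B U₀ ℓ) {y : X} (hy : y ∈ nestedHull f α B U₀ ℓ) :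
    ∃ u ∈ U₀, nndist y u ≤ zoomTail α ℓ := by
  obtain ⟨k, hk⟩ := mem_iUnion.1 hy
  rcases hullStage_structure hα hS k y hk with h | ⟨m, W, hm, hW, hgood, hyW, -⟩
  · exact ⟨y, h, by simp⟩
  · obtain ⟨u, hu, hyu⟩ := hgood y hyW
    exact ⟨u, hu, hyu.trans (hα.zoomTail_anti hS.one_le (Nat.le_of_dvd hW.one_le hm))⟩

theorem hullStage_isOpen (hS : IsSeed α B U₀ ℓ) (k : ℕ) :
    IsOpen (hullStage f α B U₀ ℓ k) := by
  induction k with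
  | zero => exact hS.isOpen_core
  | succ k ih =>
    refine ih.union (isOpen_iff_forall_mem_open.2 ?_)
    rintro y ⟨n, V, hn, hV, hz, hyV, hfy⟩
    exact ⟨V ∩ f^[n] ⁻¹' hullStage f α B U₀ ℓ k,
      fun x hx => ⟨n, V, hn, hV, hz, hx.1, hx.2⟩, hV.isOpen_inter_preimage ih, hyV, hfy⟩

theorem nestedHull_subset_base [CompactSpace X] (hα : IsZoomingContraction α)
    (hS : IsSeed α B U₀ ℓ) : nestedHull f α B U₀ ℓ ⊆ B := by
  intro y hy
  obtain ⟨u, hu, hyu⟩ := exists_core_near_of_mem_nestedHull hα hS hy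
  exact hS.collar u hu y y hyu (by simp)

theorem hullStage_isConnected [CompactSpace X] (hα : IsZoomingContraction α)
    (hS : IsSeed α B U₀ ℓ) (k : ℕ) : IsConnected (hullStage f α B U₀ ℓ k) := by
  induction k with
  | zero => exact hS.isConnected_core
  | succ k ih =>
    have hsub : hullStage f α B U₀ ℓ k ⊆ B :=
      (subset_iUnion (hullStage f α B U₀ ℓ) k).trans (nestedHull_subset_base hα hS)
    obtain ⟨x₀, hx₀⟩ := ih.nonempty
    refine ⟨⟨x₀, subset_union_left hx₀⟩, isPreconnected_of_forall x₀ fun y hy => ?_⟩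
    rcases hy with hy | ⟨n, V, hn, hV, ⟨z, hzV, hfz, hz⟩, hyV, hfy⟩
    · exact ⟨_, subset_union_left, hx₀, hy, ih.isPreconnected⟩
    · refine ⟨hullStage f α B U₀ ℓ k ∪ V ∩ f^[n] ⁻¹' hullStage f α B U₀ ℓ k,
        union_subset_union_right _ fun x hx => ⟨n, V, hn, hV, ⟨z, hzV, hfz, hz⟩, hx.1, hx.2⟩,
        Or.inl hx₀, Or.inr ⟨hyV, hfy⟩, ?_⟩
      exact IsPreconnected.union z hz ⟨hzV, hfz⟩ ih.isPreconnected
        (hV.isPreconnected_inter_preimage hsub ih.isPreconnected)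

end Hull

/-- A nested domain `U` in the base `B`, for the branches whose orders are divisible by `ℓ`: any
pullback of `U` that meets `U` is contained in `U`, and branches that meet over `U` are nested. -/
structure IsNestedDomain {X : Type*} [MetricSpace X] (f : X → X) (α : ℕ → ℝ≥0 → ℝ≥0) (B U : Set X)
    (ℓ : ℕ) : Prop where
  isOpen_base : IsOpen B
  nndist_le_one : ∀ x ∈ B, ∀ y ∈ B, nndist x y ≤ 1
  isOpen : IsOpen U
  isConnected : IsConnected U
  subset_base : U ⊆ B
  absorb : ∀ n V, ℓ ∣ n → IsBranch f α B n V → ∀ z ∈ V, f^[n] z ∈ U → z ∈ U →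
    V ∩ f^[n] ⁻¹' U ⊆ U
  branch_subset_base : ∀ n V, ℓ ∣ n → IsBranch f α B n V → (V ∩ U).Nonempty → V ⊆ B
  branch_subset_branch : ∀ m n V W, IsBranch f α B n V → IsBranch f α B m W → m ≤ n → ℓ ∣ n - m →
    ∀ y ∈ V, y ∈ W → f^[m] y ∈ U → V ⊆ W

theorem IsSeed.isNestedDomain_nestedHull {X : Type*} [MetricSpace X] [CompactSpace X] {f : X → X}
    {α : ℕ → ℝ≥0 → ℝ≥0} {B U₀ : Set X} {ℓ : ℕ} (hα : IsZoomingContraction α)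
    (hS : IsSeed α B U₀ ℓ) : IsNestedDomain f α B (nestedHull f α B U₀ ℓ) ℓ where
  isOpen_base := hS.isOpen_base
  nndist_le_one := hS.nndist_le_one
  isOpen := isOpen_iUnion fun k => hullStage_isOpen hS k
  isConnected := by
    obtain ⟨x₀, hx₀⟩ := hS.isConnected_core.nonempty
    refine ⟨⟨x₀, mem_iUnion.2 ⟨0, hx₀⟩⟩, isPreconnected_iUnion ⟨x₀, mem_iInter.2 fun k =>
      hullStage_mono (Nat.zero_le k) hx₀⟩ fun k => (hullStage_isConnected hα hS k).isPreconnected⟩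
  subset_base := nestedHull_subset_base hα hS
  absorb := by
    rintro n V hn hV z hzV hfz hz y ⟨hyV, hfy⟩
    obtain ⟨a, ha⟩ := mem_iUnion.1 hfz
    obtain ⟨b, hb⟩ := mem_iUnion.1 hz
    obtain ⟨c, hc⟩ := mem_iUnion.1 hfy
    refine mem_iUnion.2 ⟨max a (max b c) + 1, Or.inr ⟨n, V, hn, hV, ⟨z, hzV, ?_, ?_⟩, hyV, ?_⟩⟩
    · exact hullStage_mono (le_max_left _ _) ha
    · exact hullStage_mono ((le_max_left _ _).trans (le_max_right _ _)) hb
    · exact hullStage_mono ((le_max_right _ _).trans (le_max_right _ _)) hc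
  branch_subset_base := by
    rintro n V hn hV ⟨y, hyV, hy⟩ z hz
    obtain ⟨u, hu, hyu⟩ := exists_core_near_of_mem_nestedHull hα hS hy
    refine hS.collar u hu y z hyu ?_
    have := hV.nndist_le hα hS hz hyV (j := 0) hV.one_le
    exact this.trans (hα.le_zoomTail hS.one_le (Nat.le_of_dvd hV.one_le hn))
  branch_subset_branch := by
    intro m n V W hV hW hmn hℓ y hyV hyW hfy
    obtain ⟨u, hu, hyu⟩ := exists_core_near_of_mem_nestedHull hα hS hfy
    exact hS.branch_subset_branch hα hV hW hmn hℓ hyV hyW hu hyu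

/-! ### The induced Markov map of a nested domain -/

/-- The first time of `x` in the schedule `E`, and `0` if `x` has no time. -/
noncomputable def firstTime {X : Type*} (E : ℕ → Set X) (x : X) : ℕ := sInf {n | x ∈ E n}

theorem firstTime_eq {X : Type*} {E : ℕ → Set X} {n : ℕ} {x : X} (hx : x ∈ firstTimeAt E n) :
    firstTime E x = n := by
  refine le_antisymm (Nat.sInf_le hx.1) (not_lt.1 fun h => hx.2 _ h ?_)
  exact Nat.sInf_mem (s := {n | x ∈ E n}) ⟨n, hx.1⟩

theorem mem_firstTimeAt_firstTime {X : Type*} {E : ℕ → Set X} {n : ℕ} {x : X} (hx : x ∈ E n) :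
    x ∈ firstTimeAt E (firstTime E x) :=
  ⟨Nat.sInf_mem (s := {n | x ∈ E n}) ⟨n, hx⟩, fun _ hi => Nat.notMem_of_lt_sInf hi⟩

theorem exists_mem_of_one_le_firstTime {X : Type*} {E : ℕ → Set X} {x : X}
    (hx : 1 ≤ firstTime E x) : ∃ n, x ∈ E n := by
  by_contra! h
  have : firstTime E x = 0 := by simp [firstTime, h]
  omega

theorem measurable_firstTime {X : Type*} [MeasurableSpace X] {E : ℕ → Set X} (h0 : E 0 = ∅)
    (hE : ∀ n, MeasurableSet (E n)) : Measurable (firstTime E) := by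
  refine measurable_to_countable' fun n => ?_
  rcases Nat.eq_zero_or_pos n with rfl | hn
  · have : firstTime E ⁻¹' {0} = (⋃ n, E n)ᶜ := by
      ext x
      simp only [mem_preimage, mem_singleton_iff, mem_compl_iff, mem_iUnion]
      constructor
      · rintro h ⟨n, hn⟩
        have := (mem_firstTimeAt_firstTime hn).1
        rw [h, h0] at this
        exact this
      · intro h
        by_contra h'
        exact h (exists_mem_of_one_le_firstTime (Nat.one_le_iff_ne_zero.2 h'))
    rw [this]
    exact (MeasurableSet.iUnion hE).compl
  · have : firstTime E ⁻¹' {n} = firstTimeAt E n := by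
      ext x
      constructor
      · rintro rfl
        obtain ⟨k, hk⟩ := exists_mem_of_one_le_firstTime hn
        exact mem_firstTimeAt_firstTime hk
      · exact fun hx => firstTime_eq hx
    rw [this]
    exact measurableSet_firstTimeAt hE n

theorem measurable_iterate_of_measurable {X : Type*} [MeasurableSpace X] {f : X → X}
    (hf : Measurable f) {τ : X → ℕ} (hτ : Measurable τ) : Measurable fun x => f^[τ x] x := by
  have h : Measurable fun p : ℕ × X => f^[p.1] p.2 :=
    measurable_from_prod_countable_right fun n => hf.iterate n
  exact h.comp (hτ.prodMk measurable_id)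

/-- The set of points `x` for which `n` is a return time to `U`: a branch of order `n`, divisible by
`ℓ`, contains `x` and takes it to `U`. -/
def returnTimes {X : Type*} [MetricSpace X] (f : X → X) (α : ℕ → ℝ≥0 → ℝ≥0) (B U : Set X) (ℓ : ℕ)
    (n : ℕ) : Set X :=
  {x | ∃ V, ℓ ∣ n ∧ IsBranch f α B n V ∧ x ∈ V ∧ f^[n] x ∈ U}

/-- The pullbacks of `U` contained in `U` on which their order is the first return time. -/
def returnParts {X : Type*} [MetricSpace X] (f : X → X) (α : ℕ → ℝ≥0 → ℝ≥0) (B U : Set X) (ℓ : ℕ) :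
    Set (Set X) :=
  {A | ∃ n V, ℓ ∣ n ∧ IsBranch f α B n V ∧ A = V ∩ f^[n] ⁻¹' U ∧ A ⊆ U ∧
    A ⊆ firstTimeAt (returnTimes f α B U ℓ) n}

/-- The map that sends each point to its image at its first return time. -/
noncomputable def returnMap {X : Type*} [MetricSpace X] (f : X → X) (α : ℕ → ℝ≥0 → ℝ≥0)
    (B U : Set X) (ℓ : ℕ) (x : X) : X :=
  f^[firstTime (returnTimes f α B U ℓ) x] x

theorem isOpen_returnTimes {X : Type*} [MetricSpace X] {f : X → X} {α : ℕ → ℝ≥0 → ℝ≥0}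
    {B U : Set X} (hU : IsOpen U) (ℓ n : ℕ) : IsOpen (returnTimes f α B U ℓ n) :=
  isOpen_iff_forall_mem_open.2 fun _ ⟨V, hn, hV, hxV, hfx⟩ =>
    ⟨V ∩ f^[n] ⁻¹' U, fun _ hy => ⟨V, hn, hV, hy.1, hy.2⟩, hV.isOpen_inter_preimage hU, hxV, hfx⟩

namespace IsNestedDomain

variable {X : Type*} [MetricSpace X] {f : X → X} {α : ℕ → ℝ≥0 → ℝ≥0}
  {B U : Set X} {ℓ : ℕ}

theorem returnParts_eq_of_mem (hU : IsNestedDomain f α B U ℓ) {A A' : Set X}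
    (hA : A ∈ returnParts f α B U ℓ) (hA' : A' ∈ returnParts f α B U ℓ) {x : X} (hx : x ∈ A)
    (hx' : x ∈ A') : A = A' := by
  obtain ⟨n, V, hn, hV, rfl, hsub, hfirst⟩ := hA
  obtain ⟨m, W, hm, hW, rfl, hsub', hfirst'⟩ := hA'
  obtain rfl : n = m := (firstTime_eq (hfirst hx)).symm.trans (firstTime_eq (hfirst' hx'))
  have h1 := hU.branch_subset_branch n n V W hV hW le_rfl (by simp) x hx.1 hx'.1 hx.2
  have h2 := hU.branch_subset_branch n n W V hW hV le_rfl (by simp) x hx'.1 hx.1 hx.2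
  rw [h1.antisymm h2]

theorem nonempty_of_mem_returnParts (hU : IsNestedDomain f α B U ℓ) {A : Set X}
    (hA : A ∈ returnParts f α B U ℓ) : A.Nonempty := by
  obtain ⟨n, V, hn, hV, rfl, -⟩ := hA
  rw [← image_nonempty (f := f^[n]), hV.image_inter_preimage hU.subset_base]
  exact hU.isConnected.nonempty

theorem isOpen_of_mem_returnParts (hU : IsNestedDomain f α B U ℓ) {A : Set X}
    (hA : A ∈ returnParts f α B U ℓ) : IsOpen A := by
  obtain ⟨n, V, hn, hV, rfl, -⟩ := hA
  exact hV.isOpen_inter_preimage hU.isOpen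

theorem returnMap_eq {n : ℕ} {x : X} (hx : x ∈ firstTimeAt (returnTimes f α B U ℓ) n) :
    returnMap f α B U ℓ x = f^[n] x := by
  rw [returnMap, firstTime_eq hx]

theorem returnMap_image (hU : IsNestedDomain f α B U ℓ) {A : Set X}
    (hA : A ∈ returnParts f α B U ℓ) : returnMap f α B U ℓ '' A = U := by
  obtain ⟨n, V, hn, hV, rfl, hsub, hfirst⟩ := hA
  rw [image_congr fun x hx => returnMap_eq (hfirst hx), hV.image_inter_preimage hU.subset_base]

theorem returnMap_mem {x : X} (hx : x ∈ U) :
    returnMap f α B U ℓ x ∈ U := by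
  by_cases h : ∃ n, x ∈ returnTimes f α B U ℓ n
  · obtain ⟨n, hn⟩ := h
    obtain ⟨V, -, -, -, h⟩ := (mem_firstTimeAt_firstTime hn).1
    exact h
  · have : firstTime (returnTimes f α B U ℓ) x = 0 := by
      by_contra h'
      exact h (exists_mem_of_one_le_firstTime (Nat.one_le_iff_ne_zero.2 h'))
    simpa [returnMap, this] using hx

/-- Two points following the same itinerary are contracted at the rate of the total return time. -/
theorem nndist_le_of_itinerary (hα : IsZoomingContraction α) (N : ℕ) : ∀ y z : X,
    (∀ j ≤ N, ∃ A ∈ returnParts f α B U ℓ,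
      (returnMap f α B U ℓ)^[j] y ∈ A ∧ (returnMap f α B U ℓ)^[j] z ∈ A) →
    ∃ s, N + 1 ≤ s ∧ nndist y z ≤ α s (nndist ((returnMap f α B U ℓ)^[N + 1] y)
      ((returnMap f α B U ℓ)^[N + 1] z)) := by
  set F := returnMap f α B U ℓ with hF
  have hone : ∀ y z, (∃ A ∈ returnParts f α B U ℓ, y ∈ A ∧ z ∈ A) →
      ∃ n, 1 ≤ n ∧ nndist y z ≤ α n (nndist (F y) (F z)) := by
    rintro y z ⟨A, ⟨n, V, hn, hV, rfl, hsub, hfirst⟩, hy, hz⟩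
    refine ⟨n, hV.one_le, ?_⟩
    rw [hF, returnMap_eq (hfirst hy), returnMap_eq (hfirst hz)]
    simpa using hV.contract y hy.1 z hz.1 0 hV.one_le
  induction N with
  | zero =>
    intro y z h
    obtain ⟨n, hn, hle⟩ := hone y z (h 0 le_rfl)
    exact ⟨n, hn, hle⟩
  | succ N ih =>
    intro y z h
    obtain ⟨n, hn, hle⟩ := hone y z (h 0 (Nat.zero_le _))
    obtain ⟨s, hs, hle'⟩ := ih (F y) (F z) fun j hj => h (j + 1) (by omega)
    refine ⟨n + s, by omega, hle.trans ((hα.mono n hn hle').trans ?_)⟩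
    exact hα.comp_le' hn (by omega) _

variable [CompactSpace X]

theorem isSchedule (hα : IsZoomingContraction α) (hU : IsNestedDomain f α B U ℓ) :
    IsSchedule f (returnTimes f α B U ℓ) where
  zero := eq_empty_of_forall_notMem fun _ ⟨_, _, hV, _⟩ => absurd hV.one_le (by omega)
  concat := by
    rintro n m x ⟨V, hn, hV, hxV, hfx⟩ ⟨W, hm, hW, hxW, hfx'⟩
    refine ⟨V ∩ f^[n] ⁻¹' W, dvd_add hn hm,
      hV.comp hα hW (hU.branch_subset_base m W hm hW ⟨_, hxW, hfx⟩), ⟨hxV, hxW⟩, ?_⟩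
    rwa [add_comm, Function.iterate_add_apply]
  sub := by
    rintro m n x hmn ⟨W, hm, hW, hxW, hfxW⟩ ⟨V, hn, hV, hxV, hfxV⟩
    have hℓ := Nat.dvd_sub hn hm
    have hVW := hU.branch_subset_branch m n V W hV hW hmn.le hℓ x hxV hxW hfxW
    refine ⟨f^[m] '' V, hℓ, hW.image hV hU.isOpen_base hmn hVW, mem_image_of_mem _ hxV, ?_⟩
    rwa [← Function.iterate_add_apply, Nat.sub_add_cancel hmn.le]

/-- The first return time is constant on the pullback of `U` along a branch realizing it. -/
theorem exists_mem_returnParts (hU : IsNestedDomain f α B U ℓ) {x : X} (hx : x ∈ U) {n : ℕ}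
    (hxn : x ∈ firstTimeAt (returnTimes f α B U ℓ) n) :
    ∃ A ∈ returnParts f α B U ℓ, x ∈ A := by
  obtain ⟨⟨V, hn, hV, hxV, hfx⟩, hmin⟩ := hxn
  refine ⟨V ∩ f^[n] ⁻¹' U, ⟨n, V, hn, hV, rfl, hU.absorb n V hn hV x hxV hfx hx, ?_⟩, hxV, hfx⟩
  rintro y ⟨hyV, hfy⟩
  refine ⟨⟨V, hn, hV, hyV, hfy⟩, ?_⟩
  rintro m hmn ⟨W, hm, hW, hyW, hfyW⟩
  have hℓ := Nat.dvd_sub hn hm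
  have hVW := hU.branch_subset_branch m n V W hV hW hmn.le hℓ y hyV hyW hfyW
  have hit : ∀ x, f^[n - m] (f^[m] x) = f^[n] x := fun x => by
    rw [← Function.iterate_add_apply, Nat.sub_add_cancel hmn.le]
  -- the image of the branch under `f^m` meets `U` at `f^m y`, hence is absorbed
  refine hmin m hmn ⟨W, hm, hW, hVW hxV, ?_⟩
  exact hU.absorb (n - m) (f^[m] '' V) hℓ (hW.image hV hU.isOpen_base hmn hVW) (f^[m] y)
    (mem_image_of_mem _ hyV) (by rwa [hit]) hfyW
    ⟨mem_image_of_mem _ hxV, by rwa [mem_preimage, hit]⟩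

theorem isConnected_of_mem_returnParts (hU : IsNestedDomain f α B U ℓ) {A : Set X}
    (hA : A ∈ returnParts f α B U ℓ) : IsConnected A := by
  refine ⟨hU.nonempty_of_mem_returnParts hA, ?_⟩
  obtain ⟨n, V, hn, hV, rfl, -⟩ := hA
  exact hV.isPreconnected_inter_preimage hU.subset_base hU.isConnected.isPreconnected

theorem countable_returnParts (hU : IsNestedDomain f α B U ℓ) :
    (returnParts f α B U ℓ).Countable := by
  have hd : (returnParts f α B U ℓ).PairwiseDisjoint id := fun A hA A' hA' hne =>
    Set.disjoint_left.2 fun x hx hx' => hne (hU.returnParts_eq_of_mem hA hA' hx hx')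
  exact hd.countable_of_isOpen (fun A hA => hU.isOpen_of_mem_returnParts hA)
    fun A hA => hU.nonempty_of_mem_returnParts hA

theorem sUnion_returnParts (hU : IsNestedDomain f α B U ℓ) :
    ⋃₀ returnParts f α B U ℓ = U ∩ ⋃ n, returnTimes f α B U ℓ n := by
  ext x
  constructor
  · rintro ⟨A, ⟨n, V, hn, hV, rfl, hsub, hfirst⟩, hx⟩
    exact ⟨hsub hx, mem_iUnion.2 ⟨n, (hfirst hx).1⟩⟩
  · rintro ⟨hxU, hx⟩
    obtain ⟨n, hn⟩ := mem_iUnion.1 hx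
    exact hU.exists_mem_returnParts hxU (mem_firstTimeAt_firstTime hn)

variable [MeasurableSpace X] [BorelSpace X]

theorem isMarkovMap (hα : IsZoomingContraction α) (hf : Measurable f)
    (hU : IsNestedDomain f α B U ℓ) :
    IsMarkovMap (returnMap f α B U ℓ) U (returnParts f α B U ℓ) where
  measurableSet_domain := hU.isOpen.measurableSet
  mapsTo := fun x hx => returnMap_mem hx
  measurable := by
    have h : Measurable (returnMap f α B U ℓ) := measurable_iterate_of_measurable hf
      (measurable_firstTime (hU.isSchedule hα).zero
        fun n => (isOpen_returnTimes hU.isOpen ℓ n).measurableSet)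
    exact h.comp measurable_subtype_coe
  countable := hU.countable_returnParts
  measurableSet_part := fun A hA => (hU.isOpen_of_mem_returnParts hA).measurableSet
  part_subset := by
    rintro A ⟨n, V, -, -, -, hsub, -⟩
    exact hsub
  disjoint_interior := fun A hA A' hA' hne => eq_empty_of_forall_notMem fun x hx =>
    hne (hU.returnParts_eq_of_mem hA hA' (interior_subset hx.1) (interior_subset hx.2))
  markov := by
    rintro A hA A' ⟨n, V, -, -, -, hsub, -⟩ -
    rw [hU.returnMap_image hA]
    exact interior_subset.trans hsub
  finite_images := by
    refine (finite_singleton U).subset ?_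
    rintro _ ⟨A, hA, rfl⟩
    exact hU.returnMap_image hA
  homeo := by
    rintro A hA
    have himg := hU.returnMap_image hA
    obtain ⟨n, V, hn, hV, rfl, hsub, hfirst⟩ := hA
    have h := mapsHomeomorphically_of_isCompact isClosed_closure.isCompact hV.continuousOn
      hV.injOn ((inter_subset_left (t := f^[n] ⁻¹' U)).trans subset_closure)
    rw [hV.image_inter_preimage hU.subset_base] at h
    obtain ⟨e, he⟩ := h
    rw [himg]
    exact ⟨e, fun x => (he x).trans (returnMap_eq (hfirst x.2)).symm⟩
  homeo_closure := by
    rintro A hA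
    have himg := hU.returnMap_image hA
    obtain ⟨n, V, hn, hV, rfl, hsub, hfirst⟩ := hA
    have hcl : closure (V ∩ f^[n] ⁻¹' U) ⊆ closure V := closure_mono inter_subset_left
    have h := mapsHomeomorphically_of_isCompact isClosed_closure.isCompact hV.continuousOn
      hV.injOn hcl
    rw [image_closure_of_isCompact isClosed_closure.isCompact (hV.continuousOn.mono hcl),
      hV.image_inter_preimage hU.subset_base] at h
    obtain ⟨e, he⟩ := h
    rw [himg]
    exact ⟨e, fun x hx => (he x).trans (returnMap_eq (hfirst hx)).symm⟩
  diam_tendsto := by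
    intro x hxU hx
    set F := returnMap f α B U ℓ with hF
    have hmemU : ∀ n, ∀ y ∈ U, F^[n] y ∈ U := fun n y hy =>
      MapsTo.iterate (fun z hz => returnMap_mem hz) n hy
    have hlim : Tendsto (fun n => (zoomTail α (n + 1) : ℝ)) atTop (𝓝 0) := by
      have := (tendsto_zoomTail α).comp (tendsto_add_atTop_nat 1)
      exact NNReal.tendsto_coe.2 this
    refine squeeze_zero (fun n => Metric.diam_nonneg) (fun n => ?_) hlim
    refine Metric.diam_le_of_forall_dist_le (NNReal.coe_nonneg _) fun y hy z hz => ?_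
    obtain ⟨s, hs, hle⟩ := nndist_le_of_itinerary hα n y z fun j hj => by
      obtain ⟨A, hA, hxA, hyA⟩ := hy.2 j hj
      obtain ⟨A', hA', hxA', hzA'⟩ := hz.2 j hj
      obtain rfl := hU.returnParts_eq_of_mem hA hA' hxA hxA'
      exact ⟨A, hA, hyA, hzA'⟩
    rw [dist_nndist, NNReal.coe_le_coe]
    calc nndist y z ≤ α s 1 := hle.trans (hα.mono s (by omega) (hU.nndist_le_one _
          (hU.subset_base (hmemU _ y hy.1)) _ (hU.subset_base (hmemU _ z hz.1))))
      _ ≤ zoomTail α (n + 1) := hα.le_zoomTail (by omega) hs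

/-- The first return map to a nested domain, as an induced Markov map. -/
noncomputable def inducedMarkovMap (hα : IsZoomingContraction α) (hf : Measurable f)
    (hU : IsNestedDomain f α B U ℓ) : InducedMarkovMap f where
  domain := U
  map := returnMap f α B U ℓ
  parts := returnParts f α B U ℓ
  time := firstTime (returnTimes f α B U ℓ)
  isMarkovMap := hU.isMarkovMap hα hf
  one_le_time := by
    rw [hU.sUnion_returnParts]
    ext x
    constructor
    · rintro ⟨hx, h⟩
      exact ⟨hx, mem_iUnion.2 (exists_mem_of_one_le_firstTime h)⟩
    · rintro ⟨hx, h⟩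
      obtain ⟨n, hn⟩ := mem_iUnion.1 h
      obtain ⟨V, -, hV, -⟩ := (mem_firstTimeAt_firstTime hn).1
      exact ⟨hx, hV.one_le⟩
  time_const := by
    rintro A ⟨n, V, -, -, -, -, hfirst⟩ x hx y hy
    rw [firstTime_eq (hfirst hx), firstTime_eq (hfirst hy)]
  map_eq := fun _ _ => rfl

/-- An ergodic measure with positive upper frequency of return times to a nested domain lifts to its
first return map. -/
theorem isLiftable (hα : IsZoomingContraction α) (hf : Measurable f)
    (hU : IsNestedDomain f α B U ℓ) {μ : Measure X} [IsProbabilityMeasure μ] (hμ : Ergodic f μ)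
    {q : ℕ} (hpos : μ {x | ∃ᶠ n in atTop,
      n ≤ q * hitCount (returnTimes f α B U ℓ) (Finset.Icc 1 n) x} ≠ 0) :
    (hU.inducedMarkovMap hα hf).IsLiftable μ := by
  set E := returnTimes f α B U ℓ with hE
  have hEm : ∀ n, MeasurableSet (E n) := fun n => (isOpen_returnTimes hU.isOpen ℓ n).measurableSet
  have hUm : MeasurableSet U := hU.isOpen.measurableSet
  have hpre : ∀ (i : ℕ) {S : Set X}, MeasurableSet S → MeasurableSet (f^[i] ⁻¹' S) :=
    fun i S hS => (hf.iterate i) hS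
  obtain ⟨ν, hνfin, hνμ, hνU, hνE, hinv, hlift⟩ := (hU.isSchedule hα).exists_lift hμ hEm hpos hUm
    fun n x ⟨V, _, _, _, h⟩ => h
  refine ⟨ν, hνfin, hνμ, hνU, fun S hS => ?_, ?_⟩
  · change ν (U ∩ returnMap f α B U ℓ ⁻¹' S) = ν S
    have hF : Measurable (returnMap f α B U ℓ) := measurable_iterate_of_measurable hf
      (measurable_firstTime (hU.isSchedule hα).zero hEm)
    rw [inter_comm, measure_inter_conull hνU, ← measure_inter_conull hνE, ← iUnion_firstTimeAt,
      inter_iUnion, measure_iUnion, ← hinv S hS]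
    · congr 1; funext m; congr 1
      ext x
      constructor
      · rintro ⟨hx, hm⟩
        exact ⟨hm, by rwa [mem_preimage, returnMap_eq hm] at hx⟩
      · rintro ⟨hm, hx⟩
        exact ⟨by rwa [mem_preimage, returnMap_eq hm], hm⟩
    · exact fun m n hmn => (pairwise_disjoint_firstTimeAt E hmn).mono inter_subset_right
        inter_subset_right
    · exact fun m => (hF hS).inter (measurableSet_firstTimeAt hEm m)
  · have hcount : Countable (returnParts f α B U ℓ) := hU.countable_returnParts.to_subtype
    have hfull : ν (⋃₀ returnParts f α B U ℓ)ᶜ = 0 := by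
      rw [hU.sUnion_returnParts, compl_inter]
      exact measure_union_null hνU hνE
    refine Measure.ext fun S hS => ?_
    rw [hlift S hS, Measure.sum_apply _ hS]
    have hsplit : ∀ T, MeasurableSet T → ν T = ∑' A : returnParts f α B U ℓ, ν (T ∩ A) := by
      intro T hT
      rw [← measure_inter_conull hfull, sUnion_eq_iUnion, inter_iUnion, measure_iUnion]
      · rintro ⟨A, hA⟩ ⟨A', hA'⟩ hne
        refine Set.disjoint_left.2 fun x hx hx' => hne (Subtype.ext ?_)
        exact hU.returnParts_eq_of_mem hA hA' hx.2 hx'.2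
      · exact fun A => hT.inter (hU.isOpen_of_mem_returnParts A.2).measurableSet
    calc ∑' j, ν (noTimeUpTo E j ∩ f^[j] ⁻¹' S)
        = ∑' j, ∑' A : returnParts f α B U ℓ, ν (noTimeUpTo E j ∩ f^[j] ⁻¹' S ∩ A) := by
          congr 1; funext j
          exact hsplit _ ((measurableSet_noTimeUpTo hEm j).inter (hpre j hS))
      _ = ∑' A : returnParts f α B U ℓ, ∑' j, ν (noTimeUpTo E j ∩ f^[j] ⁻¹' S ∩ A) :=
          ENNReal.tsum_comm
      _ = _ := by
          congr 1; funext ⟨A, hA⟩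
          have hA' := hA
          obtain ⟨n, V, hn, hV, rfl, hsub, hfirst⟩ := hA'
          have htime : (hU.inducedMarkovMap hα hf).partTime (V ∩ f^[n] ⁻¹' U) = n := by
            have : firstTime E '' (V ∩ f^[n] ⁻¹' U) = {n} := by
              rw [image_congr fun x hx => firstTime_eq (hfirst hx)]
              exact (hU.nonempty_of_mem_returnParts hA).image_const n
            change sSup (firstTime E '' (V ∩ f^[n] ⁻¹' U)) = n
            rw [this, csSup_singleton]
          simp only [htime]
          rw [Measure.finsetSum_apply, tsum_eq_sum (s := Finset.range n)]
          · refine Finset.sum_congr rfl fun j hj => ?_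
            rw [Measure.map_apply (hf.iterate j) hS, Measure.restrict_apply (hpre j hS)]
            congr 1
            ext x
            refine ⟨fun h => ⟨h.1.2, h.2⟩, fun h => ⟨⟨fun i hi => ?_, h.1⟩, h.2⟩⟩
            exact (hfirst h.2).2 i (lt_of_le_of_lt hi (Finset.mem_range.1 hj))
          · intro j hj
            rw [Finset.mem_range, not_lt] at hj
            convert measure_empty (μ := ν)
            refine eq_empty_of_forall_notMem fun x hx => ?_
            exact hx.1.1 n hj (hfirst hx.2).1

end IsNestedDomain

/-! ### From zooming times to return times -/

/-- Local connectedness provides a core and a base around each point; the order `ℓ` is then chosen by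
the summability of the contractions at scale `1`, which bounds the diameter of the base. -/
theorem exists_isSeed {X : Type*} [MetricSpace X] [LocallyConnectedSpace X] (α : ℕ → ℝ≥0 → ℝ≥0)
    {δ : ℝ} (hδ : 0 < δ) (c : X) : ∃ (B U₀ : Set X) (ℓ : ℕ), IsSeed α B U₀ ℓ ∧ c ∈ U₀ ∧ U₀ ⊆ B ∧
      ∀ x ∈ U₀, B ⊆ Metric.ball x δ := by
  set ρ : ℝ := min (δ / 2) (1 / 2) with hρ
  have hρ0 : 0 < ρ := by positivity
  have hρδ : ρ ≤ δ / 2 := min_le_left _ _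
  have hρ1 : ρ ≤ 1 / 2 := min_le_right _ _
  set B := connectedComponentIn (Metric.ball c ρ) c with hB
  have hBo : IsOpen B := Metric.isOpen_ball.connectedComponentIn
  have hBsub : B ⊆ Metric.ball c ρ := connectedComponentIn_subset _ _
  obtain ⟨η, hη0, hηB⟩ := Metric.isOpen_iff.1 hBo c
    (mem_connectedComponentIn (Metric.mem_ball_self hρ0))
  set U₀ := connectedComponentIn (Metric.ball c (η / 4)) c with hU₀
  have hcU : c ∈ Metric.ball c (η / 4) := Metric.mem_ball_self (by positivity)
  have hUsub : U₀ ⊆ Metric.ball c (η / 4) := connectedComponentIn_subset _ _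
  have hUB : U₀ ⊆ B := hUsub.trans ((Metric.ball_subset_ball (by linarith)).trans hηB)
  have hη8 : (0 : ℝ≥0) < (η / 8).toNNReal := Real.toNNReal_pos.2 (by positivity)
  obtain ⟨ℓ, hℓ, hℓ1⟩ := (((tendsto_zoomTail α).eventually (gt_mem_nhds hη8)).and
    (eventually_ge_atTop 1)).exists
  have htail : (zoomTail α ℓ : ℝ) ≤ η / 8 := by
    have := NNReal.coe_le_coe.2 hℓ.le
    rwa [Real.coe_toNNReal _ (by positivity)] at this
  refine ⟨B, U₀, ℓ, ⟨hBo, isPreconnected_connectedComponentIn, fun x hx y hy => ?_,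
    Metric.isOpen_ball.connectedComponentIn, isConnected_connectedComponentIn_iff.2 hcU, hℓ1,
    fun u hu y z hyu hzy => hηB ?_⟩, mem_connectedComponentIn hcU, hUB, fun x hx y hy => ?_⟩
  · rw [← NNReal.coe_le_coe, ← dist_nndist, NNReal.coe_one]
    have h1 := Metric.mem_ball.1 (hBsub hx)
    have h2 := Metric.mem_ball.1 (hBsub hy)
    have := dist_triangle_right x y c
    linarith
  · rw [← NNReal.coe_le_coe, ← dist_nndist] at hyu hzy
    have h1 := Metric.mem_ball.1 (hUsub hu)
    have h2 := dist_triangle4 z y u c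
    rw [Metric.mem_ball]
    linarith
  · have h1 := Metric.mem_ball.1 (hBsub (hUB hx))
    have h2 := Metric.mem_ball.1 (hBsub hy)
    have := dist_triangle_right y x c
    rw [Metric.mem_ball]
    linarith

/-- The part of a zooming pre-ball lying over an open subset of its image ball is a branch. -/
theorem IsZoomingPreball.isBranch {X : Type*} [MetricSpace X] {f : X → X} {α : ℕ → ℝ≥0 → ℝ≥0}
    {δ : ℝ} {n : ℕ} {p : X} {V B : Set X} (hV : IsZoomingPreball α δ f n p V) (hn : 1 ≤ n)
    (hB : IsOpen B) (hBsub : B ⊆ Metric.ball (f^[n] p) δ) :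
    IsBranch f α B n (V ∩ f^[n] ⁻¹' B) where
  one_le := hn
  isOpen := (hV.homeo.continuousOn.mono subset_closure).isOpen_inter_preimage hV.isOpen hB
  image_eq := by rw [image_inter_preimage, hV.image_eq, inter_eq_right.2 hBsub]
  continuousOn := hV.homeo.continuousOn.mono (closure_mono inter_subset_left)
  injOn := hV.homeo.injOn.mono (closure_mono inter_subset_left)
  contract := fun x hx y hy j hj => hV.contract x hx.1 y hy.1 j hj

/-- Pigeonhole principle for positive upper frequencies. -/
theorem exists_frequently_of_cover {X ι : Type*} {S : ℕ → Set X} {T : ι → ℕ → Set X} {I : Finset ι}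
    {x : X} (hcov : ∀ n, x ∈ S n → ∃ i ∈ I, x ∈ T i n) {q : ℕ}
    (hS : ∃ᶠ n in atTop, n ≤ q * hitCount S (Finset.Icc 1 n) x) :
    ∃ i ∈ I, ∃ᶠ n in atTop, n ≤ (q * I.card) * hitCount (T i) (Finset.Icc 1 n) x := by
  classical
  by_contra! h
  have h' : ∀ᶠ n in atTop, ∀ i ∈ I, (q * I.card) * hitCount (T i) (Finset.Icc 1 n) x < n :=
    (eventually_all_finset I).2 fun i hi => h i hi
  obtain ⟨n, hn, hlt, hn1⟩ := (hS.and_eventually (h'.and (eventually_ge_atTop 1))).exists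
  have hle : hitCount S (Finset.Icc 1 n) x ≤ ∑ i ∈ I, hitCount (T i) (Finset.Icc 1 n) x := by
    unfold hitCount
    refine (Finset.card_le_card fun k hk => ?_).trans Finset.card_biUnion_le
    rw [Finset.mem_filter] at hk
    obtain ⟨i, hi, hx⟩ := hcov k hk.2
    exact Finset.mem_biUnion.2 ⟨i, hi, Finset.mem_filter.2 ⟨hk.1, hx⟩⟩
  rcases I.eq_empty_or_nonempty with rfl | hI
  · simp only [Finset.sum_empty, Nat.le_zero] at hle
    rw [hle] at hn
    omega
  · have h2 : ∑ i ∈ I, (q * I.card) * hitCount (T i) (Finset.Icc 1 n) x < ∑ _i ∈ I, n :=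
      Finset.sum_lt_sum_of_nonempty hI hlt
    rw [← Finset.mul_sum, Finset.sum_const, smul_eq_mul] at h2
    have h3 : I.card * n ≤ I.card * (q * ∑ i ∈ I, hitCount (T i) (Finset.Icc 1 n) x) :=
      Nat.mul_le_mul_left _ (hn.trans (Nat.mul_le_mul_left q hle))
    have h4 : I.card * (q * ∑ i ∈ I, hitCount (T i) (Finset.Icc 1 n) x) =
      q * I.card * ∑ i ∈ I, hitCount (T i) (Finset.Icc 1 n) x := by ring
    omega

/-- If branches over the base take `x` into the core with positive upper frequency, then some forward
iterate of `x` has positive upper frequency of return times. The first branch order in the most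
frequent residue class modulo `ℓ` is used as the new origin of times. -/
theorem IsSeed.exists_frequently_returnTimes {X : Type*} [MetricSpace X] [CompactSpace X]
    {f : X → X} {α : ℕ → ℝ≥0 → ℝ≥0} {B U₀ : Set X} {ℓ : ℕ} (hα : IsZoomingContraction α)
    (hS : IsSeed α B U₀ ℓ) {x : X} {q : ℕ}
    (hx : ∃ᶠ n in atTop, n ≤ q * hitCount
      (fun n => {x | ∃ V, IsBranch f α B n V ∧ x ∈ V ∧ f^[n] x ∈ U₀}) (Finset.Icc 1 n) x) :
    ∃ n₀ q', ∃ᶠ n in atTop, n ≤ q' * hitCount (returnTimes f α B (nestedHull f α B U₀ ℓ) ℓ)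
      (Finset.Icc 1 n) (f^[n₀] x) := by
  classical
  obtain ⟨a, -, ha⟩ := exists_frequently_of_cover (I := Finset.range ℓ)
    (T := fun a n => {x | (∃ V, IsBranch f α B n V ∧ x ∈ V ∧ f^[n] x ∈ U₀) ∧ n % ℓ = a})
    (fun n hn => ⟨n % ℓ, Finset.mem_range.2 (Nat.mod_lt _ hS.one_le), hn, rfl⟩) hx
  rw [Finset.card_range] at ha
  set T : ℕ → Set X :=
    fun n => {x | (∃ V, IsBranch f α B n V ∧ x ∈ V ∧ f^[n] x ∈ U₀) ∧ n % ℓ = a} with hT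
  set Q := q * ℓ
  set E := returnTimes f α B (nestedHull f α B U₀ ℓ) ℓ
  obtain ⟨n₀, hn₀⟩ : ∃ n₀, x ∈ T n₀ := by
    obtain ⟨n, hn, hn1⟩ := (ha.and_eventually (eventually_ge_atTop 1)).exists
    by_contra! h
    have : hitCount T (Finset.Icc 1 n) x = 0 := by simp [hitCount, h]
    rw [this] at hn
    omega
  refine ⟨n₀, 2 * Q, (ha.and_eventually (eventually_ge_atTop (2 * Q * n₀))).mono ?_⟩
  rintro n ⟨hn, hnQ⟩
  have hstep : ∀ k, n₀ < k → x ∈ T k → f^[n₀] x ∈ E (k - n₀) := by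
    rintro k hk ⟨⟨V, hV, hxV, hfV⟩, hka⟩
    obtain ⟨⟨W, hW, hxW, hfW⟩, hna⟩ := hn₀
    have hℓ : ℓ ∣ k - n₀ := (Nat.modEq_iff_dvd' hk.le).1 (hna.trans hka.symm)
    have hVW := hS.branch_subset_branch hα hV hW hk.le hℓ hxV hxW hfW (by simp)
    refine ⟨f^[n₀] '' V, hℓ, hW.image hV hS.isOpen_base hk hVW, mem_image_of_mem _ hxV, ?_⟩
    rw [← Function.iterate_add_apply, Nat.sub_add_cancel hk.le]
    exact mem_iUnion.2 ⟨0, hfV⟩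
  have hcount : hitCount T (Finset.Icc 1 n) x ≤ n₀ + hitCount E (Finset.Icc 1 n) (f^[n₀] x) := by
    have hsplit : hitCount T (Finset.Icc 1 n) x ≤
        (Finset.Icc 1 n₀).card + ((Finset.Icc 1 n).filter fun k => x ∈ T k ∧ n₀ < k).card := by
      unfold hitCount
      refine (Finset.card_le_card fun k hk => ?_).trans (Finset.card_union_le _ _)
      simp only [Finset.mem_filter, Finset.mem_Icc, Finset.mem_union] at hk ⊢
      rcases le_or_gt k n₀ with h | h
      · exact Or.inl ⟨hk.1.1, h⟩
      · exact Or.inr ⟨hk.1, hk.2, h⟩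
    refine hsplit.trans (add_le_add (by simp) ?_)
    unfold hitCount
    refine Finset.card_le_card_of_injOn (fun k => k - n₀) (fun k hk => ?_) fun i hi j hj hij => ?_
    · simp only [Finset.coe_filter, Finset.mem_Icc, mem_ofPred_eq] at hk ⊢
      exact ⟨by omega, hstep k hk.2.2 hk.2.1⟩
    · simp only [Finset.coe_filter, Finset.mem_Icc, mem_ofPred_eq] at hi hj hij
      omega
  have := Nat.mul_le_mul_left Q hcount
  nlinarith

theorem exists_frequently_of_limsup_pos {X : Type*} {S : ℕ → Set X} {x : X}
    (h : 0 < limsup (fun n : ℕ => (({j : ℕ | 1 ≤ j ∧ j ≤ n ∧ x ∈ S j}.ncard : ℕ) : ℝ) / (n : ℝ))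
      atTop) :
    ∃ q, ∃ᶠ n in atTop, n ≤ q * hitCount S (Finset.Icc 1 n) x := by
  classical
  obtain ⟨K, hK⟩ := exists_nat_one_div_lt h
  refine ⟨K + 1, (frequently_lt_of_lt_limsup (isCoboundedUnder_le_of_le atTop (x := 0)
    fun n => by positivity) hK).mono fun n hn => ?_⟩
  have hcard : {j : ℕ | 1 ≤ j ∧ j ≤ n ∧ x ∈ S j}.ncard = hitCount S (Finset.Icc 1 n) x := by
    unfold hitCount
    rw [← Set.ncard_coe_finset]
    congr 1
    ext j
    simp [and_assoc]
  rw [hcard] at hn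
  rcases Nat.eq_zero_or_pos n with rfl | hn0
  · simp
  have hn0' : (0 : ℝ) < n := by exact_mod_cast hn0
  rw [div_lt_div_iff₀ (by positivity) hn0', one_mul] at hn
  have : n < hitCount S (Finset.Icc 1 n) x * (K + 1) := by exact_mod_cast hn
  linarith

theorem mainTheorem5 {X : Type*} [MetricSpace X] [CompactSpace X] [LocallyConnectedSpace X]
    [MeasurableSpace X] [BorelSpace X] (f : X → X) (hf : Measurable f)
    (α : ℕ → ℝ≥0 → ℝ≥0) (hα : IsZoomingContraction α) (δ : ℝ) (hδ : 0 < δ)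
    (Λ : Set X) (hΛ : IsZoomingSet α δ f Λ) :
    ∃ 𝔉 : Set (InducedMarkovMap f),
      𝔉.Finite ∧ IsMarkovStructure f Λ 𝔉 ∧
      (∀ G ∈ 𝔉, G.IsFull ∧ IsTopologicalOpenBall G.domain ∧
        ∀ A ∈ G.parts, IsTopologicalOpenBall A) ∧
      (∀ μ : Measure X, IsProbabilityMeasure μ → Ergodic f μ → 0 < μ Λ →
        ∃ G ∈ 𝔉, G.IsLiftable μ) := by
  choose B U₀ ℓ hS hc hUB hBδ using fun c : X => exists_isSeed α hδ c
  obtain ⟨t, ht⟩ := isCompact_univ.elim_nhds_subcover U₀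
    fun c _ => (hS c).isOpen_core.mem_nhds (hc c)
  have hN : ∀ c, IsNestedDomain f α (B c) (nestedHull f α (B c) (U₀ c) (ℓ c)) (ℓ c) :=
    fun c => (hS c).isNestedDomain_nestedHull hα
  let E : X → ℕ → Set X :=
    fun c => returnTimes f α (B c) (nestedHull f α (B c) (U₀ c) (ℓ c)) (ℓ c)
  let A : X → ℕ → Set X :=
    fun c q => {x | ∃ᶠ n in atTop, n ≤ q * hitCount (E c) (Finset.Icc 1 n) x}
  have hcover : Λ ⊆ ⋃ c ∈ t, ⋃ n₀, ⋃ q, f^[n₀] ⁻¹' A c q := by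
    intro x hx
    obtain ⟨q, hq⟩ := exists_frequently_of_limsup_pos (S := fun n => {x | IsZoomingTime α δ f n x})
      (hΛ.2 x hx)
    obtain ⟨c, hct, hfreq⟩ := exists_frequently_of_cover (I := t)
      (T := fun c n => {x | ∃ V, IsBranch f α (B c) n V ∧ x ∈ V ∧ f^[n] x ∈ U₀ c}) (by
        rintro n ⟨hn, V, hV⟩
        obtain ⟨c, hct, hxc⟩ := mem_iUnion₂.1 (ht.2 (mem_univ (f^[n] x)))
        exact ⟨c, hct, _, hV.isBranch hn (hS c).isOpen_base (hBδ c _ hxc),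
          ⟨hV.mem, hUB c hxc⟩, hxc⟩) hq
    obtain ⟨n₀, q', h⟩ := (hS c).exists_frequently_returnTimes hα hfreq
    exact mem_iUnion₂.2 ⟨c, hct, mem_iUnion₂.2 ⟨n₀, q', h⟩⟩
  have hlift : ∀ μ : Measure X, IsProbabilityMeasure μ → Ergodic f μ → 0 < μ Λ →
      ∃ G ∈ (fun c => (hN c).inducedMarkovMap hα hf) '' (t : Set X), G.IsLiftable μ := by
    intro μ _ hμ hpos
    obtain ⟨c, hct, q, hcq⟩ : ∃ c ∈ t, ∃ q, μ (A c q) ≠ 0 := by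
      by_contra! h
      refine hpos.ne' (measure_mono_null hcover ?_)
      refine (measure_biUnion_null_iff t.countable_toSet).2 fun c hct => ?_
      refine measure_iUnion_null fun n₀ => measure_iUnion_null fun q => ?_
      exact (hμ.toMeasurePreserving.iterate n₀).quasiMeasurePreserving.preimage_null (h c hct q)
    exact ⟨_, mem_image_of_mem _ hct, (hN c).isLiftable hα hf hμ hcq⟩
  refine ⟨(fun c => (hN c).inducedMarkovMap hα hf) '' (t : Set X), t.finite_toSet.image _,
    ⟨(t.finite_toSet.image _).countable, fun μ hp hμ hμΛ => hlift μ hp hμ (by simp [hμΛ])⟩,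
    ?_, hlift⟩
  rintro _ ⟨c, -, rfl⟩
  exact ⟨fun P hP => (hN c).returnMap_image hP, ⟨(hN c).isOpen, (hN c).isConnected⟩,
    fun P hP => ⟨(hN c).isOpen_of_mem_returnParts hP, (hN c).isConnected_of_mem_returnParts hP⟩⟩
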